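/- **Theorem 3.6.** Let $m\ge 2$, let $(M^m,g)$ and $(N^{m+1},h)$ be smooth Riemannian manifolds with $M$ connected, and suppose that $\mathrm{Ric}^N=\lambda h$ for a constant $\lambda\in\mathbb{R}$. Let $\phi:(M^m,g)\to(N^{m+1},h)$ be a smooth isometric immersion which is totally umbilical, i.e. for every unit normal vector $\nu$ at a point the shape operator satisfies $A_\nu X=H_\nu X$ for all tangent vectors $X$, where $H_\nu=\frac1m\operatorname{trace}A_\nu$. Let $\tau(\phi)=\mathrm{Trace}_g\nabla d\phi$ be the tension field and $$\tau_2(\phi)=\mathrm{Trace}_g(\nabla^\phi\nabla^\phi-\nabla^\phi_{\nabla^M})\tau(\phi)-\mathrm{Trace}_gR^N(d\phi,\tau(\phi))d\phi$$ the bitension field, where $R^N(X,Y)Z=[\nabla^N_X,\nabla^N_Y]Z-\nabla^N_{[X,Y]}Z$. The hypersurface is called biharmonic if $\tau_2(\phi)=0$, and $f$-biharmonic if there is a smooth function $f:M\to(0,\infty)$ with $$f\,\tau_2(\phi)+(\Delta f)\,\tau(\phi)+2\nabla^\phi_{\mathrm{grad} f}\,\tau(\phi)=0 .$$ Then the hypersurface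 is $f$-biharmonic if and only if one of the following holds: - it is totally geodesic; - it is biharmonic, $\lambda\ge 0$, and there is a smooth unit normal vector field along $\phi$ with respect to which its mean curvature is constant, $H=\sqrt{\lambda/m}$ or $H=-\sqrt{\lambda/m}$. -/

import Mathlib

open scoped Manifold ContDiff

noncomputable section

namespace FBiharmonic

/-- A smooth Riemannian metric on a smooth manifold `M` of dimension `n`. -/
abbrev Metric (n : ℕ) (M : Type*) [TopologicalSpace M] [ChartedSpace (EuclideanSpace ℝ (Fin n)) M]
    [IsManifold (𝓡 n) ∞ M] :=
  Bundle.ContMDiffRiemannianMetric (𝓡 n) ∞ (EuclideanSpace ℝ (Fin n))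
    (fun p : M => TangentSpace (𝓡 n) p)

section OneManifold

variable {n : ℕ} {M : Type*} [TopologicalSpace M] [ChartedSpace (EuclideanSpace ℝ (Fin n)) M]

/-- The derivative at `p`, in the direction `v`, of a function on `M` with values in a fixed
normed space. -/
def dirDeriv {F : Type*} [NormedAddCommGroup F] [NormedSpace ℝ F] (f : M → F) (p : M)
    (v : TangentSpace (𝓡 n) p) : F :=
  mfderiv (𝓡 n) 𝓘(ℝ, F) f p v

/-- The coordinate basis of `T_pM` given by the preferred chart at `p`. -/
def coordBasis (p : M) (i : Fin n) : TangentSpace (𝓡 n) p :=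
  (EuclideanSpace.single i (1 : ℝ) : EuclideanSpace ℝ (Fin n))

variable [IsManifold (𝓡 n) ∞ M]

/-- The vector field which has value `v` at `p` and constant coefficients with respect to the
coordinate frame of the preferred chart at `p` (it is `0` outside the domain of that chart). -/
def coordField (p : M) (v : TangentSpace (𝓡 n) p) : Π q : M, TangentSpace (𝓡 n) q :=
  haveI : IsManifold (𝓡 n) 1 M := IsManifold.of_le (n := ∞) (by simp)
  fun q => (trivializationAt (EuclideanSpace ℝ (Fin n)) (TangentSpace (𝓡 n) : M → Type _) p).symmL
    ℝ q v

variable (g : Metric n M)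

/-- The matrix `(g_ij)` at `p` in the coordinate basis. -/
def gram (p : M) : Matrix (Fin n) (Fin n) ℝ :=
  Matrix.of fun i j => g.inner p (coordBasis p i) (coordBasis p j)

/-- The metric trace `∑ g^{ij} B(∂_i, ∂_j)` of a bilinear map on `T_pM`. -/
def metricTrace {W : Type*} [AddCommGroup W] [Module ℝ W] (p : M)
    (B : TangentSpace (𝓡 n) p → TangentSpace (𝓡 n) p → W) : W :=
  ∑ i, ∑ j, (gram g p)⁻¹ i j • B (coordBasis p i) (coordBasis p j)

/-- The tangent vector `∑ g^{ij} α(∂_j) ∂_i` dual to a linear form `α` on `T_pM`. -/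
def sharp (p : M) (α : TangentSpace (𝓡 n) p → ℝ) : TangentSpace (𝓡 n) p :=
  ∑ i, ∑ j, ((gram g p)⁻¹ i j * α (coordBasis p j)) • coordBasis p i

/-- The Christoffel symbol `Γ(v, w) = v^i w^j Γ_ij^k ∂_k` at `p` of the preferred chart at `p`:
`g(Γ(v, w), z) = (∂_v g(w, z) + ∂_w g(v, z) - ∂_z g(v, w)) / 2`. -/
def christoffel (p : M) (v w : TangentSpace (𝓡 n) p) : TangentSpace (𝓡 n) p :=
  sharp g p fun z => (1 / 2 : ℝ) *
    (dirDeriv (fun q => g.inner q (coordField p w q) (coordField p z q)) p v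
      + dirDeriv (fun q => g.inner q (coordField p v q) (coordField p z q)) p w
      - dirDeriv (fun q => g.inner q (coordField p v q) (coordField p w q)) p z)

/-- The gradient of a function. -/
def grad (f : M → ℝ) (p : M) : TangentSpace (𝓡 n) p :=
  sharp g p (dirDeriv f p)

end OneManifold

section Connection

variable {m n : ℕ}
  {M : Type*} [TopologicalSpace M] [ChartedSpace (EuclideanSpace ℝ (Fin m)) M]
  {N : Type*} [TopologicalSpace N] [ChartedSpace (EuclideanSpace ℝ (Fin n)) N]
  [IsManifold (𝓡 n) ∞ N]

/-- The differential of a map. -/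
def differential (φ : M → N) (p : M) (v : TangentSpace (𝓡 m) p) : TangentSpace (𝓡 n) (φ p) :=
  mfderiv (𝓡 m) (𝓡 n) φ p v

/-- The coefficients of a section `V` along `φ` in the coordinate frame of the preferred
chart of `N` at `φ p`. -/
def coeffAlong (φ : M → N) (V : Π q : M, TangentSpace (𝓡 n) (φ q)) (p : M) :
    M → EuclideanSpace ℝ (Fin n) :=
  haveI : IsManifold (𝓡 n) 1 N := IsManifold.of_le (n := ∞) (by simp)
  fun q => (trivializationAt (EuclideanSpace ℝ (Fin n)) (TangentSpace (𝓡 n) : N → Type _) (φ p)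
    (⟨φ q, V q⟩ : TangentBundle (𝓡 n) N)).2

/-- The vector `v(V^a) ∂_a` at `φ p`, where `V^a` are the coefficients of `V` in the coordinate
frame of the preferred chart at `φ p`. -/
def frameDeriv (φ : M → N) (V : Π q : M, TangentSpace (𝓡 n) (φ q)) (p : M)
    (v : TangentSpace (𝓡 m) p) : TangentSpace (𝓡 n) (φ p) :=
  dirDeriv (F := EuclideanSpace ℝ (Fin n)) (coeffAlong φ V p) p v

/-- The covariant derivative `∇^φ_v V` of a section `V` of `φ^* TN`, for the pull-back of the
Levi-Civita connection of `(N, h)`: in the chart at `φ p` it is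
`v(V^a) ∂_a + Γ(dφ(v), V)`. -/
def covAlong (h : Metric n N) (φ : M → N) (V : Π q : M, TangentSpace (𝓡 n) (φ q)) (p : M)
    (v : TangentSpace (𝓡 m) p) : TangentSpace (𝓡 n) (φ p) :=
  frameDeriv φ V p v + christoffel h (φ p) (differential φ p v) (V p)

/-- The Levi-Civita covariant derivative `∇_v Y` of a vector field. -/
def nabla (h : Metric n N) (Y : Π y : N, TangentSpace (𝓡 n) y) (y : N) (v : TangentSpace (𝓡 n) y) :
    TangentSpace (𝓡 n) y :=
  covAlong h (fun x : N => x) Y y v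

/-- The curvature operator `R(u, v) w = [∇_X, ∇_Y] Z - ∇_[X,Y] Z`, where `X, Y, Z` extend
`u, v, w`. -/
def curvature (h : Metric n N) (y : N) (u v w : TangentSpace (𝓡 n) y) : TangentSpace (𝓡 n) y :=
  nabla h (fun x => nabla h (coordField y w) x (coordField y v x)) y u
    - nabla h (fun x => nabla h (coordField y w) x (coordField y u x)) y v
    - nabla h (coordField y w) y
        (VectorField.mlieBracket (𝓡 n) (coordField y u) (coordField y v) y)

/-- The Ricci curvature `Ric(v, w) = trace (u ↦ R(u, v) w)`. -/
def ricci (h : Metric n N) (y : N) (v w : TangentSpace (𝓡 n) y) : ℝ :=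
  metricTrace h y fun u u' => h.inner y (curvature h y u v w) u'

/-- `(N, h)` is an Einstein space with `Ric = lam h`. -/
def IsEinstein (h : Metric n N) (lam : ℝ) : Prop :=
  ∀ (y : N) (v w : TangentSpace (𝓡 n) y), ricci h y v w = lam * h.inner y v w

/-- The Laplace operator on functions: the trace of the Hessian
`(u, v) ↦ u(Y f) - (∇_u Y) f`, where `Y` extends `v`. -/
def laplacian (h : Metric n N) (f : N → ℝ) (y : N) : ℝ :=
  metricTrace h y fun u v =>
    dirDeriv (fun x => dirDeriv f x (coordField y v x)) y u
      - dirDeriv f y (nabla h (coordField y v) y u)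

/-- `ν` is a unit vector normal to `dφ(T_pM)`. -/
def IsUnitNormal (h : Metric n N) (φ : M → N) (p : M) (ν : TangentSpace (𝓡 n) (φ p)) : Prop :=
  h.inner (φ p) ν ν = 1 ∧ ∀ v : TangentSpace (𝓡 m) p, h.inner (φ p) (differential φ p v) ν = 0

end Connection

section Maps

variable {m n : ℕ}
  {M : Type*} [TopologicalSpace M] [ChartedSpace (EuclideanSpace ℝ (Fin m)) M]
  [IsManifold (𝓡 m) ∞ M]
  {N : Type*} [TopologicalSpace N] [ChartedSpace (EuclideanSpace ℝ (Fin n)) N]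
  [IsManifold (𝓡 n) ∞ N]
  (g : Metric m M) (h : Metric n N) (φ : M → N)

/-- The second fundamental form `(∇dφ)(u, v) = ∇^φ_u (dφ Y) - dφ (∇_u Y)` of a map, where `Y`
extends `v`. -/
def secondFundamentalForm (p : M) (u v : TangentSpace (𝓡 m) p) : TangentSpace (𝓡 n) (φ p) :=
  covAlong h φ (fun q => differential φ q (coordField p v q)) p u
    - differential φ p (nabla g (coordField p v) p u)

/-- The tension field `τ(φ) = Trace_g ∇dφ`. -/
def tension (p : M) : TangentSpace (𝓡 n) (φ p) :=
  metricTrace g p (secondFundamentalForm g h φ p)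

/-- The second covariant derivative `(∇^φ∇^φ - ∇^φ_{∇^M}) V`, i.e.
`(u, v) ↦ ∇^φ_u ∇^φ_Y V - ∇^φ_{∇_u Y} V`, where `Y` extends `v`. -/
def secondCovDeriv (V : Π q : M, TangentSpace (𝓡 n) (φ q)) (p : M)
    (u v : TangentSpace (𝓡 m) p) : TangentSpace (𝓡 n) (φ p) :=
  covAlong h φ (fun q => covAlong h φ V q (coordField p v q)) p u
    - covAlong h φ V p (nabla g (coordField p v) p u)

/-- The bitension field
`τ₂(φ) = Trace_g (∇^φ∇^φ - ∇^φ_{∇^M}) τ(φ) - Trace_g R^N(dφ, τ(φ)) dφ`. -/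
def bitension (p : M) : TangentSpace (𝓡 n) (φ p) :=
  metricTrace g p (secondCovDeriv g h φ (tension g h φ) p)
    - metricTrace g p fun u v =>
        curvature h (φ p) (differential φ p u) (tension g h φ p) (differential φ p v)

/-- The `f`-bitension field `τ_{2,f}(φ) = f τ₂(φ) + (Δf) τ(φ) + 2 ∇^φ_{grad f} τ(φ)`. -/
def fBitension (f : M → ℝ) (p : M) : TangentSpace (𝓡 n) (φ p) :=
  f p • bitension g h φ p + laplacian g f p • tension g h φ p
    + (2 : ℝ) • covAlong h φ (tension g h φ) p (grad g f p)

/-- `φ` is a biharmonic map. -/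
def IsBiharmonic : Prop := ∀ p, bitension g h φ p = 0

/-- `φ` is an `f`-biharmonic map, for a given function `f`. -/
def IsFBiharmonicMap (f : M → ℝ) : Prop := ∀ p, fBitension g h φ f p = 0

/-- A submanifold `φ` is `f`-biharmonic if it is an `f`-biharmonic map for some smooth positive
function `f` on it. -/
def IsFBiharmonicSubmanifold : Prop :=
  ∃ f : M → ℝ, ContMDiff (𝓡 m) 𝓘(ℝ, ℝ) ∞ f ∧ (∀ p, 0 < f p) ∧ IsFBiharmonicMap g h φ f

/-- `φ` is a smooth isometric immersion: `g = φ^* h`. -/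
def IsIsometricImmersion : Prop :=
  ContMDiff (𝓡 m) (𝓡 n) ∞ φ ∧ ∀ (p : M) (u v : TangentSpace (𝓡 m) p),
    h.inner (φ p) (differential φ p u) (differential φ p v) = g.inner p u v

/-- The shape operator `A_ν` with respect to a normal vector `ν`:
`g(A_ν u, v) = h((∇dφ)(u, v), ν)`. -/
def shapeOperator (p : M) (ν : TangentSpace (𝓡 n) (φ p)) (u : TangentSpace (𝓡 m) p) :
    TangentSpace (𝓡 m) p :=
  sharp g p fun v => h.inner (φ p) (secondFundamentalForm g h φ p u v) ν

/-- The mean curvature `H = (1/m) Trace A_ν` of a hypersurface with respect to the unit normal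
vector `ν`. -/
def meanCurvature (p : M) (ν : TangentSpace (𝓡 n) (φ p)) : ℝ :=
  (1 / (m : ℝ)) * metricTrace g p fun u v => g.inner p (shapeOperator g h φ p ν u) v

/-- A hypersurface is totally umbilical if `A(X) = H X` for all tangent vectors `X`. -/
def IsTotallyUmbilical : Prop :=
  ∀ (p : M) (ν : TangentSpace (𝓡 n) (φ p)), IsUnitNormal (m := m) h φ p ν →
    ∀ u : TangentSpace (𝓡 m) p, shapeOperator g h φ p ν u = meanCurvature g h φ p ν • u

/-- `φ` is totally geodesic: its second fundamental form vanishes. -/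
def IsTotallyGeodesic : Prop :=
  ∀ (p : M) (u v : TangentSpace (𝓡 m) p), secondFundamentalForm g h φ p u v = 0

/-- The hypersurface has a smooth unit normal vector field `ξ` with respect to which its mean
curvature function is the constant `c`. -/
def HasConstantMeanCurvature (c : ℝ) : Prop :=
  ∃ ξ : Π p : M, TangentSpace (𝓡 n) (φ p),
    ContMDiff (𝓡 m) (𝓡 n).tangent ∞ (fun p => (⟨φ p, ξ p⟩ : TangentBundle (𝓡 n) N)) ∧
    (∀ p, IsUnitNormal (m := m) h φ p (ξ p)) ∧ ∀ p, meanCurvature g h φ p (ξ p) = c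

end Maps

end FBiharmonic

end

/-! The tension field `τ` of an isometric immersion is normal, and umbilicity gives the second
fundamental form `(1/m) g ⊗ τ`. Where `τ ≠ 0`, put `ν = τ/|τ|` and `k = |τ|/m`; then `∇ν = -k dφ`.
Differentiating once more gives the Codazzi identity `R(dφ u, dφ v) ν = dk(v) dφ u - dk(u) dφ v`.
Its trace is `Ric(dφ v, ν) = (m-1) dk(v)`, and the left side is `λ h(dφ v, ν) = 0`. So `d|τ|² = 0`
where `τ ≠ 0`; where `τ = 0`, the function `|τ|²` has a minimum and its differential vanishes as
well (`dirDeriv_tensionSq`). As `M` is connected, `|τ|² = s` is constant.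

If `s = 0`, umbilicity makes the hypersurface totally geodesic. If `s ≠ 0`, then `∇τ = -(s/m) dφ`,
hence `τ₂ = (λ - s/m) τ` (`covAlong_tension`, `bitension_eq`). The tangential part of the
`f`-biharmonic equation is `-(2s/m) dφ(grad f) = 0`, so `f` is constant; the normal part then says
`λ = s/m`. Thus `τ₂ = 0`, `λ ≥ 0`, and `H = √s/m = √(λ/m)` along `τ/|τ|`. Conversely, a biharmonic
map is `f`-biharmonic with `f = 1`, and a totally geodesic one has `τ = 0`.

The geometric objects are defined at each point through the preferred chart of that same point, so
differentiating them twice needs formulas in one fixed chart. The central one is `coframe_covAlong`.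
It does not use the transformation law of Christoffel symbols: metric compatibility and vanishing
torsion give the Koszul formula in every chart, and that determines the connection. -/

set_option linter.unusedSectionVars false
set_option maxSynthPendingDepth 3

noncomputable section

namespace FBiharmonic

open Filter Topology

/-! ### Coordinate frames and functions read in a chart. -/

section Coordinates

variable {n : ℕ} {M : Type*} [TopologicalSpace M] [ChartedSpace (EuclideanSpace ℝ (Fin n)) M]
  [IsManifold (𝓡 n) ∞ M]

/-- The coordinate frame of the chart at `p`, evaluated at `q`. -/
def frame (p q : M) : EuclideanSpace ℝ (Fin n) →L[ℝ] TangentSpace (𝓡 n) q :=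
  (trivializationAt (EuclideanSpace ℝ (Fin n)) (TangentSpace (𝓡 n) : M → Type _) p).symmL ℝ q

/-- The coefficients of a tangent vector at `q` in the coordinate frame of the chart at `p`. -/
def coframe (p q : M) : TangentSpace (𝓡 n) q →L[ℝ] EuclideanSpace ℝ (Fin n) :=
  (trivializationAt (EuclideanSpace ℝ (Fin n))
    (TangentSpace (𝓡 n) : M → Type _) p).continuousLinearMapAt ℝ q

variable {p q : M}

theorem coframe_frame (hq : q ∈ (extChartAt (𝓡 n) p).source) (v : EuclideanSpace ℝ (Fin n)) :
    coframe p q (frame p q v) = v :=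
  (trivializationAt (EuclideanSpace ℝ (Fin n))
    (TangentSpace (𝓡 n) : M → Type _) p).continuousLinearMapAt_symmL (by simpa using hq) v

theorem frame_coframe (hq : q ∈ (extChartAt (𝓡 n) p).source) (v : TangentSpace (𝓡 n) q) :
    frame p q (coframe p q v) = v :=
  (trivializationAt (EuclideanSpace ℝ (Fin n))
    (TangentSpace (𝓡 n) : M → Type _) p).symmL_continuousLinearMapAt (by simpa using hq) v

theorem coframe_eq_mfderiv (hq : q ∈ (extChartAt (𝓡 n) p).source) :
    coframe p q = mfderiv (𝓡 n) 𝓘(ℝ, EuclideanSpace ℝ (Fin n)) (extChartAt (𝓡 n) p) q :=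
  TangentBundle.continuousLinearMapAt_trivializationAt (by simpa using hq)

theorem frame_eq_mfderiv (hq : q ∈ (extChartAt (𝓡 n) p).source) :
    frame p q = mfderiv 𝓘(ℝ, EuclideanSpace ℝ (Fin n)) (𝓡 n) (extChartAt (𝓡 n) p).symm
      (extChartAt (𝓡 n) p q) := by
  rw [← mfderivWithin_univ, frame, TangentBundle.symmL_trivializationAt (by simpa using hq),
    modelWithCornersSelf_coe, Set.range_id]

/-- The tangent space at `p` is the model space by way of the preferred chart at `p`, so that chart
has the identity as its derivative at `p`. -/
theorem coframe_self (v : TangentSpace (𝓡 n) p) : coframe p p v = v := by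
  rw [coframe_eq_mfderiv (mem_extChartAt_source p), mfderiv_extChartAt_self]
  rfl

theorem frame_self (v : EuclideanSpace ℝ (Fin n)) : frame p p v = v := by
  have := frame_coframe (mem_extChartAt_source (I := 𝓡 n) p) (v : TangentSpace (𝓡 n) p)
  exact (congrArg (frame p p) (coframe_self (p := p) v)).symm.trans this

theorem coordField_self (v : TangentSpace (𝓡 n) p) : coordField p v p = v := frame_self v

theorem mdifferentiableAt_extChartAt_symm {x : EuclideanSpace ℝ (Fin n)}
    (hx : x ∈ (extChartAt (𝓡 n) p).target) :
    MDifferentiableAt 𝓘(ℝ, EuclideanSpace ℝ (Fin n)) (𝓡 n) (extChartAt (𝓡 n) p).symm x := by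
  have := mdifferentiableWithinAt_extChartAt_symm (I := 𝓡 n) hx
  simpa [mdifferentiableWithinAt_univ] using this

theorem contMDiffAt_extChartAt_symm' {x : EuclideanSpace ℝ (Fin n)}
    (hx : x ∈ (extChartAt (𝓡 n) p).target) :
    ContMDiffAt 𝓘(ℝ, EuclideanSpace ℝ (Fin n)) (𝓡 n) ∞ (extChartAt (𝓡 n) p).symm x :=
  (contMDiffOn_extChartAt_symm p).contMDiffAt ((isOpen_extChartAt_target p).mem_nhds hx)

theorem contMDiffAt_extChartAt_of_mem (hq : q ∈ (extChartAt (𝓡 n) p).source) :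
    ContMDiffAt (𝓡 n) 𝓘(ℝ, EuclideanSpace ℝ (Fin n)) ∞ (extChartAt (𝓡 n) p) q :=
  contMDiffAt_extChartAt' (by simpa using hq)

section Functions

variable {F : Type*} [NormedAddCommGroup F] [NormedSpace ℝ F]

variable (n) in
/-- A function on `M` read in the chart at `p`. -/
def localFun (f : M → F) (p : M) (x : EuclideanSpace ℝ (Fin n)) : F :=
  f ((extChartAt (𝓡 n) p).symm x)

theorem localFun_apply {f : M → F} (hq : q ∈ (extChartAt (𝓡 n) p).source) :
    localFun n f p (extChartAt (𝓡 n) p q) = f q := by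
  rw [localFun, (extChartAt (𝓡 n) p).left_inv hq]

theorem dirDeriv_frame {f : M → F} (hq : q ∈ (extChartAt (𝓡 n) p).source)
    (hf : MDifferentiableAt (𝓡 n) 𝓘(ℝ, F) f q) (u : EuclideanSpace ℝ (Fin n)) :
    dirDeriv f q (frame p q u) = fderiv ℝ (localFun n f p) (extChartAt (𝓡 n) p q) u := by
  rw [← mfderiv_eq_fderiv, frame_eq_mfderiv hq, dirDeriv]
  have hx := (extChartAt (𝓡 n) p).map_source hq
  have hl := (extChartAt (𝓡 n) p).left_inv hq
  have := mfderiv_comp_of_eq (I := 𝓘(ℝ, EuclideanSpace ℝ (Fin n))) (I' := 𝓡 n) (I'' := 𝓘(ℝ, F))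
    (x := extChartAt (𝓡 n) p q) (g := f) hf (mdifferentiableAt_extChartAt_symm hx) hl
  change _ = mfderiv _ _ (f ∘ (extChartAt (𝓡 n) p).symm) _ u
  rw [this, hl]
  rfl

theorem contDiffAt_localFun {k : ℕ∞ω} (hk : k ≤ ∞) {f : M → F}
    (hq : q ∈ (extChartAt (𝓡 n) p).source)
    (hf : ContMDiffAt (𝓡 n) 𝓘(ℝ, F) k f q) :
    ContDiffAt ℝ k (localFun n f p) (extChartAt (𝓡 n) p q) := by
  rw [← contMDiffAt_iff_contDiffAt]
  refine ContMDiffAt.comp_of_eq (I' := 𝓡 n) hf ?_ ((extChartAt (𝓡 n) p).left_inv hq)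
  exact (contMDiffAt_extChartAt_symm' ((extChartAt (𝓡 n) p).map_source hq)).of_le hk

theorem contMDiffAt_of_contDiffAt_localFun {k : ℕ∞ω} (hk : k ≤ ∞) {f : M → F}
    (hq : q ∈ (extChartAt (𝓡 n) p).source)
    (hf : ContDiffAt ℝ k (localFun n f p) (extChartAt (𝓡 n) p q)) :
    ContMDiffAt (𝓡 n) 𝓘(ℝ, F) k f q := by
  have := hf.contMDiffAt.comp q ((contMDiffAt_extChartAt_of_mem hq).of_le hk)
  refine this.congr_of_eventuallyEq ?_
  filter_upwards [(isOpen_extChartAt_source (I := 𝓡 n) p).mem_nhds hq] with r hr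
  rw [Function.comp_apply, localFun_apply hr]

theorem dirDeriv_congr {f f' : M → F} (hf : f =ᶠ[𝓝 q] f') (v : TangentSpace (𝓡 n) q) :
    dirDeriv f q v = dirDeriv f' q v := by
  rw [dirDeriv, dirDeriv]
  exact congrArg (fun L : EuclideanSpace ℝ (Fin n) →L[ℝ] F => L v) hf.mfderiv_eq

theorem dirDeriv_const (c : F) (v : TangentSpace (𝓡 n) q) :
    dirDeriv (fun _ => c) q v = 0 := by
  rw [dirDeriv]
  exact congrArg (fun L : EuclideanSpace ℝ (Fin n) →L[ℝ] F => L v)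
    (mfderiv_const (I := 𝓡 n) (I' := 𝓘(ℝ, F)) (c := c) (x := q))

end Functions

end Coordinates

/-! ### Maps, and sections along maps, read in charts. -/

section Maps

variable {m n : ℕ}
  {M : Type*} [TopologicalSpace M] [ChartedSpace (EuclideanSpace ℝ (Fin m)) M]
  [IsManifold (𝓡 m) ∞ M]
  {N : Type*} [TopologicalSpace N] [ChartedSpace (EuclideanSpace ℝ (Fin n)) N]
  [IsManifold (𝓡 n) ∞ N]

variable (m n) in
/-- A map read in the charts at `p` and `y`. -/
def localMap (φ : M → N) (p : M) (y : N) (x : EuclideanSpace ℝ (Fin m)) :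
    EuclideanSpace ℝ (Fin n) :=
  extChartAt (𝓡 n) y (φ ((extChartAt (𝓡 m) p).symm x))

variable (m) in
/-- A section along `φ`, read in the charts at `p` and `y`. -/
def localSection (φ : M → N) (V : Π q : M, TangentSpace (𝓡 n) (φ q)) (p : M) (y : N)
    (x : EuclideanSpace ℝ (Fin m)) : EuclideanSpace ℝ (Fin n) :=
  coframe y (φ ((extChartAt (𝓡 m) p).symm x)) (V ((extChartAt (𝓡 m) p).symm x))

variable {φ : M → N} {p q : M} {y : N} {k : ℕ∞ω}

theorem localMap_apply (hq : q ∈ (extChartAt (𝓡 m) p).source) :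
    localMap m n φ p y (extChartAt (𝓡 m) p q) = extChartAt (𝓡 n) y (φ q) := by
  rw [localMap, (extChartAt (𝓡 m) p).left_inv hq]

theorem localSection_apply {V : Π q : M, TangentSpace (𝓡 n) (φ q)}
    (hq : q ∈ (extChartAt (𝓡 m) p).source) :
    localSection m φ V p y (extChartAt (𝓡 m) p q) = coframe y (φ q) (V q) := by
  rw [localSection, (extChartAt (𝓡 m) p).left_inv hq]

theorem contDiffAt_localMap (hk : k ≤ ∞) (hq : q ∈ (extChartAt (𝓡 m) p).source)
    (hy : φ q ∈ (extChartAt (𝓡 n) y).source) (hφ : ContMDiffAt (𝓡 m) (𝓡 n) k φ q) :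
    ContDiffAt ℝ k (localMap m n φ p y) (extChartAt (𝓡 m) p q) :=
  contDiffAt_localFun (n := m) (f := fun r => extChartAt (𝓡 n) y (φ r)) hk hq
    (((contMDiffAt_extChartAt_of_mem (n := n) hy).of_le hk).comp q hφ)

theorem coframe_differential (hq : q ∈ (extChartAt (𝓡 m) p).source)
    (hy : φ q ∈ (extChartAt (𝓡 n) y).source) (hφ : MDifferentiableAt (𝓡 m) (𝓡 n) φ q)
    (u : EuclideanSpace ℝ (Fin m)) :
    coframe y (φ q) (differential φ q (frame p q u)) =
      fderiv ℝ (localMap m n φ p y) (extChartAt (𝓡 m) p q) u := by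
  have h1 := mdifferentiableAt_extChartAt (I := 𝓡 n) (x := y) (y := φ q)
    (by simpa using hy)
  have := dirDeriv_frame (f := fun r => extChartAt (𝓡 n) y (φ r)) hq (h1.comp q hφ) u
  change _ = fderiv ℝ (localFun m (fun r => extChartAt (𝓡 n) y (φ r)) p) _ u
  rw [← this, dirDeriv, coframe_eq_mfderiv hy, differential]
  have := mfderiv_comp (I := 𝓡 m) (I' := 𝓡 n) q h1 hφ
  exact (congrArg (fun L : EuclideanSpace ℝ (Fin m) →L[ℝ] EuclideanSpace ℝ (Fin n) =>
    L (frame p q u)) this).symm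

theorem dirDeriv_comp {F : Type*} [NormedAddCommGroup F] [NormedSpace ℝ F] {f : N → F}
    (hf : MDifferentiableAt (𝓡 n) 𝓘(ℝ, F) f (φ q)) (hφ : MDifferentiableAt (𝓡 m) (𝓡 n) φ q)
    (v : TangentSpace (𝓡 m) q) :
    dirDeriv (fun r => f (φ r)) q v = dirDeriv (n := n) f (φ q) (differential φ q v) := by
  have := mfderiv_comp (I := 𝓡 m) (I' := 𝓡 n) (I'' := 𝓘(ℝ, F)) q hf hφ
  exact (congrArg (fun L : EuclideanSpace ℝ (Fin m) →L[ℝ] F => L v) this)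

theorem differential_id (v : TangentSpace (𝓡 m) q) : differential (fun r : M => r) q v = v := by
  have := mfderiv_id (I := 𝓡 m) (x := q)
  exact (congrArg (fun L : EuclideanSpace ℝ (Fin m) →L[ℝ] EuclideanSpace ℝ (Fin m) => L v) this)

variable (m) in
/-- Smoothness at `q` of a section along `φ`. -/
def SmoothAt (φ : M → N) (V : Π q : M, TangentSpace (𝓡 n) (φ q)) (q : M) : Prop :=
  ContMDiffAt (𝓡 m) (𝓡 n).tangent ∞ (fun r => (⟨φ r, V r⟩ : TangentBundle (𝓡 n) N)) q

variable {V : Π q : M, TangentSpace (𝓡 n) (φ q)}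

theorem trivializationAt_snd {y z : N} (hz : z ∈ (extChartAt (𝓡 n) y).source)
    (w : TangentSpace (𝓡 n) z) :
    (trivializationAt (EuclideanSpace ℝ (Fin n)) (TangentSpace (𝓡 n) : N → Type _) y
      (⟨z, w⟩ : TangentBundle (𝓡 n) N)).2 = coframe y z w := by
  rw [coframe, Bundle.Trivialization.continuousLinearMapAt_apply,
    Bundle.Trivialization.coe_linearMapAt_of_mem _ (by simpa using hz)]

theorem smoothAt_iff_of_mem (hy : φ q ∈ (extChartAt (𝓡 n) y).source) :
    SmoothAt m φ V q ↔ ContMDiffAt (𝓡 m) (𝓡 n) ∞ φ q ∧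
      ContMDiffAt (𝓡 m) 𝓘(ℝ, EuclideanSpace ℝ (Fin n)) ∞ (fun r => coframe y (φ r) (V r)) q := by
  have := (trivializationAt (EuclideanSpace ℝ (Fin n))
    (TangentSpace (𝓡 n) : N → Type _) y).contMDiffAt_iff (IM := 𝓡 m) (IB := 𝓡 n) (n := ∞)
    (f := fun r => (⟨φ r, V r⟩ : TangentBundle (𝓡 n) N)) (x₀ := q) (by
      rw [Bundle.Trivialization.mem_source]; simpa using hy)
  rw [SmoothAt]
  refine this.trans (and_congr_right fun h => ?_)
  refine Filter.EventuallyEq.contMDiffAt_iff ?_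
  filter_upwards [h.continuousAt.preimage_mem_nhds
    ((isOpen_extChartAt_source (I := 𝓡 n) y).mem_nhds hy)] with r hr
  exact trivializationAt_snd hr _

theorem SmoothAt.base (hV : SmoothAt m φ V q) : ContMDiffAt (𝓡 m) (𝓡 n) ∞ φ q :=
  ((smoothAt_iff_of_mem (mem_extChartAt_source (φ q))).1 hV).1

theorem SmoothAt.contDiffAt (hV : SmoothAt m φ V q) (hq : q ∈ (extChartAt (𝓡 m) p).source)
    (hy : φ q ∈ (extChartAt (𝓡 n) y).source) :
    ContDiffAt ℝ ∞ (localSection m φ V p y) (extChartAt (𝓡 m) p q) :=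
  contDiffAt_localFun le_rfl hq ((smoothAt_iff_of_mem hy).1 hV).2

theorem smoothAt_of_contDiffAt (hφ : ContMDiffAt (𝓡 m) (𝓡 n) ∞ φ q)
    (hq : q ∈ (extChartAt (𝓡 m) p).source)
    (hy : φ q ∈ (extChartAt (𝓡 n) y).source)
    (hV : ContDiffAt ℝ ∞ (localSection m φ V p y) (extChartAt (𝓡 m) p q)) :
    SmoothAt m φ V q :=
  (smoothAt_iff_of_mem hy).2 ⟨hφ, contMDiffAt_of_contDiffAt_localFun le_rfl hq hV⟩

theorem smoothAt_coordField {v : TangentSpace (𝓡 m) p} (hq : q ∈ (extChartAt (𝓡 m) p).source) :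
    SmoothAt m (fun r : M => r) (coordField p v) q := by
  refine (smoothAt_iff_of_mem hq).2 ⟨contMDiffAt_id, ?_⟩
  have hc : ContMDiffAt (𝓡 m) 𝓘(ℝ, EuclideanSpace ℝ (Fin m)) ∞
    (fun _ : M => (show EuclideanSpace ℝ (Fin m) from v)) q := contMDiffAt_const
  refine hc.congr_of_eventuallyEq ?_
  filter_upwards [(isOpen_extChartAt_source (I := 𝓡 m) p).mem_nhds hq] with r hr
  exact coframe_frame hr v

end Maps

/-! ### Linear algebra of one inner product: dual pairs, traces, index raising. -/

section MetricAlgebra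

variable {n : ℕ} {M : Type*} [TopologicalSpace M] [ChartedSpace (EuclideanSpace ℝ (Fin n)) M]
  [IsManifold (𝓡 n) ∞ M] (g : Metric n M) (p : M)

theorem inner_self_eq_zero_iff {v : TangentSpace (𝓡 n) p} : g.inner p v v = 0 ↔ v = 0 := by
  refine ⟨fun h => ?_, fun h => by simp [h]⟩
  by_contra hv
  exact (g.pos p v hv).ne' h

variable {g p} in
theorem eq_of_inner_eq {v w : TangentSpace (𝓡 n) p}
    (h : ∀ z, g.inner p v z = g.inner p w z) : v = w := by
  have := h (v - w)
  rw [← sub_eq_zero, ← inner_self_eq_zero_iff g p]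
  simpa [sub_eq_zero] using this

/-- `(b, b')` is a pair of finite families for which `v = ∑ ⟨v, b' i⟩ b i`. -/
def IsDualPair {ι : Type*} [Fintype ι] (b b' : ι → TangentSpace (𝓡 n) p) : Prop :=
  ∀ v, ∑ i, g.inner p v (b' i) • b i = v

/-- The family dual to the coordinate basis. -/
def dualBasis (i : Fin n) : TangentSpace (𝓡 n) p :=
  ∑ j, (gram g p)⁻¹ i j • coordBasis p j

theorem sum_coordBasis (v : TangentSpace (𝓡 n) p) :
    ∑ i, (show EuclideanSpace ℝ (Fin n) from v) i • coordBasis p i = v := by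
  have := (EuclideanSpace.basisFun (Fin n) ℝ).sum_repr (show EuclideanSpace ℝ (Fin n) from v)
  simpa using! this

theorem gram_symm (i j : Fin n) : gram g p i j = gram g p j i := g.symm p _ _

/-- A kernel vector `x` gives `v = ∑ x i ∂_i` orthogonal to every `∂_i`, hence to itself, so `v = 0`
by positivity. -/
theorem isUnit_gram : IsUnit (gram g p) := by
  rw [← Matrix.mulVec_injective_iff_isUnit]
  rw [← Matrix.coe_mulVecLin, injective_iff_map_eq_zero]
  intro x hx
  set v : TangentSpace (𝓡 n) p := ∑ i, x i • coordBasis p i with hv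
  have h1 : ∀ i, g.inner p (coordBasis p i) v = 0 := by
    intro i
    have := congrFun hx i
    rw [Matrix.mulVecLin_apply, Matrix.mulVec, dotProduct] at this
    rw [hv, map_sum, ← Pi.zero_apply (M := fun _ => ℝ) i, ← this]
    refine Finset.sum_congr rfl fun j _ => ?_
    rw [map_smul, smul_eq_mul, mul_comm]
    rfl
  have h2 : v = 0 := by
    rw [← inner_self_eq_zero_iff g p]
    have : ∀ w, w = v → g.inner p v w = 0 := by
      intro w hw
      rw [hw.trans hv, map_sum]
      refine Finset.sum_eq_zero fun i _ => ?_
      rw [map_smul, g.symm, h1, smul_zero]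
    exact this v rfl
  have h3 := (EuclideanSpace.basisFun (Fin n) ℝ).toBasis.linearIndependent
  rw [Fintype.linearIndependent_iff] at h3
  funext i
  exact h3 x (by simpa using! h2) i

theorem isDualPair_coordBasis : IsDualPair g p (coordBasis p) (dualBasis g p) := by
  have hG : (gram g p)⁻¹ * gram g p = 1 :=
    Matrix.nonsing_inv_mul _ ((Matrix.isUnit_iff_isUnit_det _).1 (isUnit_gram g p))
  intro v
  conv_rhs => rw [← sum_coordBasis p v]
  refine Finset.sum_congr rfl fun i _ => ?_
  congr 1
  have hc : ∀ k, g.inner p (coordBasis p k) (dualBasis g p i) = if i = k then 1 else 0 := by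
    intro k
    have := congrFun (congrFun hG i) k
    rw [Matrix.mul_apply, Matrix.one_apply] at this
    rw [← this, dualBasis, map_sum]
    refine Finset.sum_congr rfl fun j _ => ?_
    rw [map_smul, smul_eq_mul, gram_symm]
    rfl
  conv_lhs => rw [← sum_coordBasis p v]
  rw [map_sum, _root_.sum_apply]
  simp [hc]

variable {g p}

theorem IsDualPair.symm {ι : Type*} [Fintype ι] {b b' : ι → TangentSpace (𝓡 n) p}
    (h : IsDualPair g p b b') : IsDualPair g p b' b := by
  intro v
  refine eq_of_inner_eq (g := g) fun z => ?_
  conv_rhs => rw [← h z]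
  rw [map_sum, _root_.sum_apply, map_sum]
  refine Finset.sum_congr rfl fun i _ => ?_
  rw [map_smul, map_smul, _root_.smul_apply, smul_eq_mul, smul_eq_mul, mul_comm,
    g.symm p (b' i) z]

/-- The trace does not depend on the frame. It is evaluated below in the frame of a fixed chart, to
see smoothness, and in a frame adapted to the hypersurface, to split off the normal term of the
Ricci curvature. -/
theorem metricTrace_eq_sum {W : Type*} [AddCommGroup W] [Module ℝ W] {ι : Type*} [Fintype ι]
    {b b' : ι → TangentSpace (𝓡 n) p} (h : IsDualPair g p b b')
    (B : TangentSpace (𝓡 n) p →ₗ[ℝ] TangentSpace (𝓡 n) p →ₗ[ℝ] W) :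
    metricTrace g p (fun u v => B u v) = ∑ i, B (b i) (b' i) := by
  have h1 : metricTrace g p (fun u v => B u v) = ∑ i, B (coordBasis p i) (dualBasis g p i) := by
    refine Finset.sum_congr rfl fun i _ => ?_
    rw [dualBasis, map_sum]
    exact Finset.sum_congr rfl fun j _ => (map_smul _ _ _).symm
  rw [h1]
  -- Expand `∂_i` in the family `b`; after exchanging the sums, the sum over `i` reassembles `b' j`
  -- from the coordinate dual pair.
  have h2 : ∀ i, B (coordBasis p i) (dualBasis g p i) =
      ∑ j, g.inner p (coordBasis p i) (b' j) • B (b j) (dualBasis g p i) := by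
    intro i
    conv_lhs => rw [← h (coordBasis p i)]
    simp
  simp only [h2]
  rw [Finset.sum_comm]
  refine Finset.sum_congr rfl fun j _ => ?_
  conv_rhs => rw [← (isDualPair_coordBasis g p).symm (b' j)]
  rw [map_sum]
  refine Finset.sum_congr rfl fun i _ => ?_
  rw [map_smul, g.symm]

theorem sharp_eq (α : TangentSpace (𝓡 n) p →ₗ[ℝ] ℝ) :
    sharp g p (fun v => α v) = ∑ i, α (dualBasis g p i) • coordBasis p i := by
  refine Finset.sum_congr rfl fun i _ => ?_
  rw [dualBasis, map_sum, Finset.sum_smul]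
  simp

theorem inner_sharp (α : TangentSpace (𝓡 n) p →ₗ[ℝ] ℝ) (v : TangentSpace (𝓡 n) p) :
    g.inner p (sharp g p (fun v => α v)) v = α v := by
  rw [sharp_eq, map_sum, _root_.sum_apply]
  conv_rhs => rw [← (isDualPair_coordBasis g p).symm v, map_sum]
  refine Finset.sum_congr rfl fun i _ => ?_
  rw [map_smul, map_smul, _root_.smul_apply, smul_eq_mul, smul_eq_mul, mul_comm,
    g.symm p _ v]

theorem sum_inner_dualPair {ι : Type*} [Fintype ι] {b b' : ι → TangentSpace (𝓡 n) p}
    (h : IsDualPair g p b b') : ∑ i, g.inner p (b i) (b' i) = n := by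
  have h1 := metricTrace_eq_sum h (LinearMap.mk₂ ℝ (fun u v => g.inner p u v) (by simp) (by simp)
    (by simp) (by simp))
  simp only [LinearMap.mk₂_apply] at h1
  rw [← h1]
  have hG : (gram g p)⁻¹ * gram g p = 1 :=
    Matrix.nonsing_inv_mul _ ((Matrix.isUnit_iff_isUnit_det _).1 (isUnit_gram g p))
  have := congrArg Matrix.trace hG
  rw [Matrix.trace_one, Fintype.card_fin] at this
  rw [← this, metricTrace, Matrix.trace]
  refine Finset.sum_congr rfl fun i _ => ?_
  rw [Matrix.diag_apply, Matrix.mul_apply]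
  refine Finset.sum_congr rfl fun j _ => ?_
  rw [gram_symm, smul_eq_mul]
  rfl

end MetricAlgebra

/-! ### The metric in a chart: smoothness and nondegeneracy. -/

section LocalMetric

variable {n : ℕ} {N : Type*} [TopologicalSpace N] [ChartedSpace (EuclideanSpace ℝ (Fin n)) N]
  [IsManifold (𝓡 n) ∞ N] (h : Metric n N) (y : N)

/-- The metric read in the chart at `y`. -/
def localMetric (x : EuclideanSpace ℝ (Fin n)) :
    EuclideanSpace ℝ (Fin n) →L[ℝ] EuclideanSpace ℝ (Fin n) →L[ℝ] ℝ :=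
  (ContinuousLinearMap.precomp ℝ (frame y ((extChartAt (𝓡 n) y).symm x))).comp
    ((h.inner ((extChartAt (𝓡 n) y).symm x)).comp (frame y ((extChartAt (𝓡 n) y).symm x)))

theorem localMetric_apply (x u v : EuclideanSpace ℝ (Fin n)) :
    localMetric h y x u v = h.inner ((extChartAt (𝓡 n) y).symm x)
      (frame y ((extChartAt (𝓡 n) y).symm x) u) (frame y ((extChartAt (𝓡 n) y).symm x) v) := rfl

variable {h y}

theorem localMetric_extChartAt {z : N} (hz : z ∈ (extChartAt (𝓡 n) y).source)
    (u v : EuclideanSpace ℝ (Fin n)) :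
    localMetric h y (extChartAt (𝓡 n) y z) u v = h.inner z (frame y z u) (frame y z v) := by
  rw [localMetric_apply, (extChartAt (𝓡 n) y).left_inv hz]

theorem inner_eq_localMetric {z : N} (hz : z ∈ (extChartAt (𝓡 n) y).source)
    (u v : TangentSpace (𝓡 n) z) :
    h.inner z u v = localMetric h y (extChartAt (𝓡 n) y z) (coframe y z u) (coframe y z v) := by
  rw [localMetric_extChartAt hz, frame_coframe hz, frame_coframe hz]

theorem localMetric_symm (x u v : EuclideanSpace ℝ (Fin n)) :
    localMetric h y x u v = localMetric h y x v u := h.symm _ _ _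

theorem contMDiffAt_inner {m : ℕ} {M : Type*} [TopologicalSpace M]
    [ChartedSpace (EuclideanSpace ℝ (Fin m)) M] [IsManifold (𝓡 m) ∞ M] {φ : M → N} {q : M}
    {V W : Π q : M, TangentSpace (𝓡 n) (φ q)}
    (hV : SmoothAt m φ V q) (hW : SmoothAt m φ W q) :
    ContMDiffAt (𝓡 m) 𝓘(ℝ, ℝ) ∞ (fun r => h.inner (φ r) (V r) (W r)) q := by
  have : ContMDiffAt (𝓡 m) ((𝓡 n).prod 𝓘(ℝ)) ∞
      (fun r => Bundle.TotalSpace.mk' ℝ (E := Bundle.Trivial N ℝ) (φ r)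
        (h.inner (φ r) (V r) (W r))) q := by
    apply ContMDiffAt.clm_bundle_apply₂ (F₁ := EuclideanSpace ℝ (Fin n))
      (F₂ := EuclideanSpace ℝ (Fin n))
    · exact ContMDiffAt.comp q h.contMDiff.contMDiffAt hV.base
    · exact hV
    · exact hW
  rw [Bundle.contMDiffAt_totalSpace] at this
  exact this.2

theorem contDiffAt_localMetric {x : EuclideanSpace ℝ (Fin n)}
    (hx : x ∈ (extChartAt (𝓡 n) y).target) : ContDiffAt ℝ ∞ (localMetric h y) x := by
  suffices H : ContDiffOn ℝ ∞ (localMetric h y) (extChartAt (𝓡 n) y).target from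
    H.contDiffAt ((isOpen_extChartAt_target y).mem_nhds hx)
  rw [contDiffOn_clm_apply]
  intro u
  rw [contDiffOn_clm_apply]
  intro v x hx
  have hz := (extChartAt (𝓡 n) y).map_target hx
  have := contDiffAt_localFun le_rfl hz (contMDiffAt_inner (h := h) (φ := fun z : N => z)
    (smoothAt_coordField (v := u) hz) (smoothAt_coordField (v := v) hz))
  rw [(extChartAt (𝓡 n) y).right_inv hx] at this
  exact this.contDiffWithinAt

/-- Positivity gives injectivity, and the dual space has the same dimension. Invertibility has to be
tracked because `ContinuousLinearMap.inverse` is `0` on noninvertible maps. -/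
theorem isInvertible_localMetric {x : EuclideanSpace ℝ (Fin n)}
    (hx : x ∈ (extChartAt (𝓡 n) y).target) : (localMetric h y x).IsInvertible := by
  have hz := (extChartAt (𝓡 n) y).map_target hx
  have hinj : Function.Injective (localMetric h y x).toLinearMap := by
    rw [injective_iff_map_eq_zero]
    intro u hu
    have h1 : localMetric h y x u u = 0 := by
      have := congrArg (fun L : EuclideanSpace ℝ (Fin n) →L[ℝ] ℝ => L u) hu
      simpa using this
    rw [localMetric_apply, inner_self_eq_zero_iff] at h1
    rw [← coframe_frame hz u, h1, map_zero]
  have hfin : Module.finrank ℝ (EuclideanSpace ℝ (Fin n)) =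
      Module.finrank ℝ (EuclideanSpace ℝ (Fin n) →L[ℝ] ℝ) := by
    rw [← (LinearMap.toContinuousLinearMap (𝕜 := ℝ) (E := EuclideanSpace ℝ (Fin n))
      (F' := ℝ)).finrank_eq]
    exact (Subspace.dual_finrank_eq).symm
  have hbij := LinearEquiv.ofInjectiveOfFinrankEq (localMetric h y x).toLinearMap hinj hfin
  refine ⟨(LinearEquiv.ofInjectiveOfFinrankEq (localMetric h y x).toLinearMap hinj
    hfin).toContinuousLinearEquiv, ?_⟩
  ext u v
  rfl

end LocalMetric

/-! ### Levi-Civita connection and curvature of a field of bilinear forms on a vector space. -/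

section Euclidean

variable {E : Type*} [NormedAddCommGroup E] [NormedSpace ℝ E]

/-- The form `(∂_a β(b, c) + ∂_b β(a, c) - ∂_c β(a, b)) / 2` of a field `β` of bilinear forms. -/
def koszulForm (β : E → E →L[ℝ] E →L[ℝ] ℝ) (x : E) : E →L[ℝ] E →L[ℝ] E →L[ℝ] ℝ :=
  (1 / 2 : ℝ) • (fderiv ℝ β x + (fderiv ℝ β x).flip -
    ((ContinuousLinearMap.flipₗᵢ ℝ E E ℝ).toContinuousLinearEquiv.toContinuousLinearMap).comp
      (fderiv ℝ β x).flip)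

/-- The Christoffel symbols of a field of symmetric nondegenerate bilinear forms. -/
def christoffelForm (β : E → E →L[ℝ] E →L[ℝ] ℝ) (x : E) : E →L[ℝ] E →L[ℝ] E :=
  (ContinuousLinearMap.compL ℝ E (E →L[ℝ] ℝ) E (β x).inverse).comp (koszulForm β x)

/-- The curvature of the connection with Christoffel symbols `Γ`. -/
def curvatureForm (Γ : E → E →L[ℝ] E →L[ℝ] E) (x a b c : E) : E :=
  fderiv ℝ Γ x a b c - fderiv ℝ Γ x b a c + Γ x a (Γ x b c) - Γ x b (Γ x a c)

variable {β : E → E →L[ℝ] E →L[ℝ] ℝ} {x : E}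

theorem koszulForm_apply (a b c : E) : koszulForm β x a b c =
    (1 / 2 : ℝ) * (fderiv ℝ β x a b c + fderiv ℝ β x b a c - fderiv ℝ β x c a b) := rfl

theorem christoffelForm_spec (hβ : (β x).IsInvertible) (a b c : E) :
    β x (christoffelForm β x a b) c = koszulForm β x a b c := by
  have : β x ((β x).inverse (koszulForm β x a b)) = koszulForm β x a b :=
    hβ.self_apply_inverse _
  exact congrArg (fun L : E →L[ℝ] ℝ => L c) this

theorem fderiv_symm_of_symm (hd : DifferentiableAt ℝ β x) (hs : ∀ x a b, β x a b = β x b a)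
    (a b c : E) : fderiv ℝ β x a b c = fderiv ℝ β x a c b := by
  have h1 : ∀ b c, fderiv ℝ (fun z => β z b c) x a = fderiv ℝ β x a b c := by
    intro b c
    have h := (hd.hasFDerivAt.clm_apply (hasFDerivAt_const b x)).clm_apply (hasFDerivAt_const c x)
    rw [h.fderiv]
    simp
  rw [← h1, ← h1]
  simp only [hs _ b c]

theorem koszulForm_add (hd : DifferentiableAt ℝ β x) (hs : ∀ x a b, β x a b = β x b a)
    (a b c : E) : koszulForm β x a b c + koszulForm β x a c b = fderiv ℝ β x a b c := by
  rw [koszulForm_apply, koszulForm_apply, fderiv_symm_of_symm hd hs a c b]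
  rw [fderiv_symm_of_symm hd hs c a b, fderiv_symm_of_symm hd hs b a c]
  ring

/-- Metric compatibility in coordinates: two Koszul forms add up to a single derivative of `β`. -/
theorem fderiv_eq_christoffelForm (hd : DifferentiableAt ℝ β x) (hs : ∀ x a b, β x a b = β x b a)
    (hβ : (β x).IsInvertible) (a b c : E) :
    fderiv ℝ β x a b c = β x (christoffelForm β x a b) c + β x b (christoffelForm β x a c) := by
  rw [hs x b, christoffelForm_spec hβ, christoffelForm_spec hβ, koszulForm_add hd hs]

theorem christoffelForm_symm (hd : DifferentiableAt ℝ β x) (hs : ∀ x a b, β x a b = β x b a)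
    (a b : E) : christoffelForm β x a b = christoffelForm β x b a := by
  have : koszulForm β x a b = koszulForm β x b a := by
    ext c
    rw [koszulForm_apply, koszulForm_apply, fderiv_symm_of_symm hd hs c a b]
    ring
  exact congrArg (β x).inverse this

theorem contDiffAt_christoffelForm [FiniteDimensional ℝ E] (hd : ContDiffAt ℝ ∞ β x)
    (hβ : (β x).IsInvertible) : ContDiffAt ℝ ∞ (christoffelForm β) x := by
  have h1 : ContDiffAt ℝ ∞ (fderiv ℝ β) x := hd.fderiv_right (by simp)
  have h2 : ContDiffAt ℝ ∞ (fun x => (fderiv ℝ β x).flip) x :=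
    (ContinuousLinearMap.flipₗᵢ ℝ E E (E →L[ℝ] ℝ)).contDiff.contDiffAt.comp x h1
  have h3 : ContDiffAt ℝ ∞ (koszulForm β) x :=
    ((h1.add h2).sub (contDiffAt_const.clm_comp h2)).const_smul _
  have h4 : ContDiffAt ℝ ∞ (fun x => (β x).inverse) x :=
    (hβ.contDiffAt_map_inverse (n := ∞)).comp x hd
  exact ((ContinuousLinearMap.compL ℝ E (E →L[ℝ] ℝ) E).contDiff.contDiffAt.comp x h4).clm_comp h3

theorem hasFDerivAt_clm_apply₂ {E' F G H : Type*} [NormedAddCommGroup E'] [NormedSpace ℝ E']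
    [NormedAddCommGroup F] [NormedSpace ℝ F] [NormedAddCommGroup G] [NormedSpace ℝ G]
    [NormedAddCommGroup H] [NormedSpace ℝ H]
    {B : E' → F →L[ℝ] G →L[ℝ] H} {v : E' → F} {w : E' → G} {x : E'}
    (hB : DifferentiableAt ℝ B x) (hv : DifferentiableAt ℝ v x) (hw : DifferentiableAt ℝ w x)
    (u : E') :
    DifferentiableAt ℝ (fun z => B z (v z) (w z)) x ∧
    fderiv ℝ (fun z => B z (v z) (w z)) x u =
      fderiv ℝ B x u (v x) (w x) + B x (fderiv ℝ v x u) (w x) + B x (v x) (fderiv ℝ w x u) := by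
  have h := (hB.hasFDerivAt.clm_apply hv.hasFDerivAt).clm_apply hw.hasFDerivAt
  refine ⟨h.differentiableAt, ?_⟩
  rw [h.fderiv]
  simp
  abel

/-- Differentiate the compatibility identity for `∂_b β` along `a` and antisymmetrise in `a`, `b`.
The second derivatives of `β` cancel by symmetry, and what is left is the curvature acting on the
two slots of `β`. -/
theorem curvatureForm_antisymm [FiniteDimensional ℝ E] (hd : ContDiffAt ℝ ∞ β x)
    (hs : ∀ x a b, β x a b = β x b a) (hβ : ∀ᶠ z in 𝓝 x, (β z).IsInvertible) (a b c d : E) :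
    β x (curvatureForm (christoffelForm β) x a b c) d +
      β x c (curvatureForm (christoffelForm β) x a b d) = 0 := by
  set Γ := christoffelForm β with hΓ
  have hΓd : DifferentiableAt ℝ Γ x :=
    (contDiffAt_christoffelForm hd hβ.self_of_nhds).differentiableAt (by simp)
  have hβd : DifferentiableAt ℝ β x := hd.differentiableAt (by simp)
  have h2 : ContDiffAt ℝ 2 β x := hd.of_le (by norm_cast)
  have hev : ∀ᶠ z in 𝓝 x, DifferentiableAt ℝ β z :=
    (h2.eventually (by simp)).mono fun z hz => hz.differentiableAt (by simp)
  have hsymm : ∀ a b : E, fderiv ℝ (fderiv ℝ β) x a b = fderiv ℝ (fderiv ℝ β) x b a :=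
    h2.isSymmSndFDerivAt (by simp)
  have hβ2 : DifferentiableAt ℝ (fderiv ℝ β) x :=
    (h2.fderiv_right (m := 1) (by norm_num)).differentiableAt (by simp)
  have hcompat : ∀ a c d, fderiv ℝ β x a c d = β x (Γ x a c) d + β x c (Γ x a d) := fun a c d =>
    fderiv_eq_christoffelForm hβd hs hβ.self_of_nhds a c d
  have hΓc : ∀ a b c, fderiv ℝ (fun z => Γ z b c) x a = fderiv ℝ Γ x a b c := by
    intro a b c
    have := (hasFDerivAt_clm_apply₂ hΓd (differentiableAt_const b) (differentiableAt_const c) a).2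
    simpa using this
  have hΓcd : ∀ b c, DifferentiableAt ℝ (fun z => Γ z b c) x := fun b c =>
    (hasFDerivAt_clm_apply₂ hΓd (differentiableAt_const b) (differentiableAt_const c) 0).1
  have key : ∀ a b, fderiv ℝ (fderiv ℝ β) x a b c d =
      fderiv ℝ β x a (Γ x b c) d + β x (fderiv ℝ Γ x a b c) d
        + fderiv ℝ β x a c (Γ x b d) + β x c (fderiv ℝ Γ x a b d) := by
    intro a b
    -- Compatibility is needed on a neighbourhood, since it is about to be differentiated.
    have e : (fun z => fderiv ℝ β z b c d) =ᶠ[𝓝 x]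
        fun z => β z (Γ z b c) d + β z c (Γ z b d) := by
      filter_upwards [hev, hβ] with z hz1 hz2
      exact fderiv_eq_christoffelForm hz1 hs hz2 b c d
    have h1 := hasFDerivAt_clm_apply₂ hβd (hΓcd b c) (differentiableAt_const d) a
    have h2 := hasFDerivAt_clm_apply₂ hβd (differentiableAt_const c) (hΓcd b d) a
    have h3 := hasFDerivAt_clm_apply₂ (B := fun z => fderiv ℝ β z b)
      (hβ2.clm_apply (differentiableAt_const b)) (differentiableAt_const c)
      (differentiableAt_const d) a
    have h4 := hβ2.hasFDerivAt.clm_apply (hasFDerivAt_const b x)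
    have h5 := congrArg (fun L : E →L[ℝ] ℝ => L a) e.fderiv_eq
    rw [h3.2, fderiv_fun_add h1.1 h2.1, _root_.add_apply, h1.2, h2.2, h4.fderiv] at h5
    simpa [hΓc, add_assoc] using h5
  have e1 := key a b
  have e2 := key b a
  rw [hsymm a b, e2] at e1
  simp only [hcompat] at e1
  simp only [curvatureForm, map_sub, map_add, _root_.sub_apply, _root_.add_apply]
  linarith

end Euclidean

/-! ### Christoffel symbols of a metric in a fixed chart. -/

section LeviCivita

variable {n : ℕ} {N : Type*} [TopologicalSpace N] [ChartedSpace (EuclideanSpace ℝ (Fin n)) N]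
  [IsManifold (𝓡 n) ∞ N] (h : Metric n N)

/-- The Christoffel symbols of `h` in the chart at `y`. -/
abbrev localChristoffel (y : N) (x : EuclideanSpace ℝ (Fin n)) :
    EuclideanSpace ℝ (Fin n) →L[ℝ] EuclideanSpace ℝ (Fin n) →L[ℝ] EuclideanSpace ℝ (Fin n) :=
  christoffelForm (localMetric h y) x

variable {h} {y z : N}

theorem differentiableAt_localMetric (hz : z ∈ (extChartAt (𝓡 n) y).source) :
    DifferentiableAt ℝ (localMetric h y) (extChartAt (𝓡 n) y z) :=
  (contDiffAt_localMetric ((extChartAt (𝓡 n) y).map_source hz)).differentiableAt (by simp)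

theorem fderiv_localMetric_apply (hz : z ∈ (extChartAt (𝓡 n) y).source)
    (u v w : EuclideanSpace ℝ (Fin n)) :
    fderiv ℝ (fun x => localMetric h y x v w) (extChartAt (𝓡 n) y z) u =
      fderiv ℝ (localMetric h y) (extChartAt (𝓡 n) y z) u v w := by
  have := (hasFDerivAt_clm_apply₂ (differentiableAt_localMetric (h := h) hz)
    (differentiableAt_const v) (differentiableAt_const w) u).2
  simpa using this

theorem dirDeriv_inner_frame (hz : z ∈ (extChartAt (𝓡 n) y).source)
    (u v w : EuclideanSpace ℝ (Fin n)) :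
    dirDeriv (fun r => h.inner r (frame y r v) (frame y r w)) z (frame y z u) =
      fderiv ℝ (localMetric h y) (extChartAt (𝓡 n) y z) u v w := by
  have hc := contMDiffAt_inner (h := h) (φ := fun z : N => z)
    (smoothAt_coordField (v := v) hz) (smoothAt_coordField (v := w) hz)
  refine (dirDeriv_frame hz (hc.mdifferentiableAt (by simp)) u).trans ?_
  rw [← fderiv_localMetric_apply hz]
  rfl

theorem coordField_eq_frame (v : TangentSpace (𝓡 n) y) :
    coordField y v z = frame y z (coframe y y v) :=
  congrArg (frame y z) (coframe_self v).symm

theorem dirDeriv_inner_coordField (u v w : TangentSpace (𝓡 n) y) :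
    dirDeriv (fun r => h.inner r (coordField y v r) (coordField y w r)) y u =
      fderiv ℝ (localMetric h y) (extChartAt (𝓡 n) y y) (coframe y y u) (coframe y y v)
        (coframe y y w) := by
  have hy := mem_extChartAt_source (I := 𝓡 n) y
  rw [← dirDeriv_inner_frame hy, frame_coframe hy]
  simp only [coordField_eq_frame]

/-- Both sides are determined by the Koszul formula at the centre of the chart: one through `sharp`,
the other through the inverse of the local metric. -/
theorem coframe_christoffel (v w : TangentSpace (𝓡 n) y) :
    coframe y y (christoffel h y v w) =
      localChristoffel h y (extChartAt (𝓡 n) y y) (coframe y y v) (coframe y y w) := by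
  have hy := mem_extChartAt_source (I := 𝓡 n) y
  have hk : christoffel h y v w = sharp h y (fun z =>
      ((koszulForm (localMetric h y) (extChartAt (𝓡 n) y y) (coframe y y v)
        (coframe y y w)).toLinearMap.comp (coframe y y).toLinearMap) z) := by
    rw [christoffel]
    congr 1
    funext z
    rw [dirDeriv_inner_coordField, dirDeriv_inner_coordField, dirDeriv_inner_coordField]
    exact (koszulForm_apply _ _ _).symm
  rw [← coframe_frame hy (localChristoffel h y _ _ _)]
  congr 1
  refine eq_of_inner_eq (g := h) fun z => ?_
  rw [hk, inner_sharp]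
  have hi := isInvertible_localMetric (h := h) ((extChartAt (𝓡 n) y).map_source hy)
  refine (christoffelForm_spec hi _ _ _).symm.trans ?_
  rw [inner_eq_localMetric hy, coframe_frame hy]
  rfl

theorem localChristoffel_symm (hz : z ∈ (extChartAt (𝓡 n) y).source)
    (u v : EuclideanSpace ℝ (Fin n)) :
    localChristoffel h y (extChartAt (𝓡 n) y z) u v =
      localChristoffel h y (extChartAt (𝓡 n) y z) v u :=
  christoffelForm_symm (differentiableAt_localMetric hz) (fun _ _ _ => localMetric_symm _ _ _) _ _

theorem contDiffAt_localChristoffel (hz : z ∈ (extChartAt (𝓡 n) y).source) :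
    ContDiffAt ℝ ∞ (localChristoffel h y) (extChartAt (𝓡 n) y z) :=
  contDiffAt_christoffelForm (contDiffAt_localMetric ((extChartAt (𝓡 n) y).map_source hz))
    (isInvertible_localMetric ((extChartAt (𝓡 n) y).map_source hz))

theorem fderiv_localMetric_eq (hz : z ∈ (extChartAt (𝓡 n) y).source)
    (a b c : EuclideanSpace ℝ (Fin n)) :
    fderiv ℝ (localMetric h y) (extChartAt (𝓡 n) y z) a b c =
      localMetric h y (extChartAt (𝓡 n) y z) (localChristoffel h y (extChartAt (𝓡 n) y z) a b) c +
      localMetric h y (extChartAt (𝓡 n) y z) b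
        (localChristoffel h y (extChartAt (𝓡 n) y z) a c) :=
  fderiv_eq_christoffelForm (differentiableAt_localMetric hz) (fun _ _ _ => localMetric_symm _ _ _)
    (isInvertible_localMetric ((extChartAt (𝓡 n) y).map_source hz)) a b c

end LeviCivita

/-! ### The pull-back connection: compatibility, torsion, independence of charts. -/

section Along

variable {m n : ℕ}
  {M : Type*} [TopologicalSpace M] [ChartedSpace (EuclideanSpace ℝ (Fin m)) M]
  [IsManifold (𝓡 m) ∞ M]
  {N : Type*} [TopologicalSpace N] [ChartedSpace (EuclideanSpace ℝ (Fin n)) N]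
  [IsManifold (𝓡 n) ∞ N] {h : Metric n N} {φ : M → N} {p q : M} {y : N}
  {V W : Π q : M, TangentSpace (𝓡 n) (φ q)}

theorem SmoothAt.mdifferentiableAt (hV : SmoothAt m φ V q) :
    MDifferentiableAt (𝓡 m) (𝓡 n) φ q := hV.base.mdifferentiableAt (by simp)

theorem eventually_mem_source (hφ : ContinuousAt φ q) (hy : φ q ∈ (extChartAt (𝓡 n) y).source) :
    ∀ᶠ r in 𝓝 q, φ r ∈ (extChartAt (𝓡 n) y).source :=
  hφ.preimage_mem_nhds ((isOpen_extChartAt_source (I := 𝓡 n) y).mem_nhds hy)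

theorem eventually_chart {P : M → Prop} (hq : q ∈ (extChartAt (𝓡 m) p).source)
    (hP : ∀ᶠ r in 𝓝 q, P r) :
    ∀ᶠ x in 𝓝 (extChartAt (𝓡 m) p q), x ∈ (extChartAt (𝓡 m) p).target ∧
      (extChartAt (𝓡 m) p).symm x ∈ (extChartAt (𝓡 m) p).source ∧
      P ((extChartAt (𝓡 m) p).symm x) := by
  have hx := (extChartAt (𝓡 m) p).map_source hq
  have h1 := (isOpen_extChartAt_target (I := 𝓡 m) p).mem_nhds hx
  have hc : Tendsto (extChartAt (𝓡 m) p).symm (𝓝 (extChartAt (𝓡 m) p q)) (𝓝 q) := by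
    have := ((continuousOn_extChartAt_symm (I := 𝓡 m) p).continuousAt h1).tendsto
    rwa [(extChartAt (𝓡 m) p).left_inv hq] at this
  filter_upwards [h1, hc.eventually hP] with x hx1 hx2
  exact ⟨hx1, (extChartAt (𝓡 m) p).map_target hx1, hx2⟩

theorem frameDeriv_frame (hV : SmoothAt m φ V q) (hq : q ∈ (extChartAt (𝓡 m) p).source)
    (u : EuclideanSpace ℝ (Fin m)) :
    frameDeriv φ V q (frame p q u) =
      fderiv ℝ (localSection m φ V p (φ q)) (extChartAt (𝓡 m) p q) u := by
  have hs := ((smoothAt_iff_of_mem (mem_extChartAt_source (I := 𝓡 n) (φ q))).1 hV).2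
  refine (dirDeriv_congr (F := EuclideanSpace ℝ (Fin n)) (f := coeffAlong φ V q) ?_ _).trans
    (dirDeriv_frame hq (hs.mdifferentiableAt (by simp)) u)
  filter_upwards [eventually_mem_source hV.base.continuousAt
    (mem_extChartAt_source (I := 𝓡 n) (φ q))]
    with r hr
  exact trivializationAt_snd hr _

/-- The source chart is already arbitrary here, but the target chart is still the preferred one at
`φ q`. `coframe_covAlong` removes that restriction. -/
theorem covAlong_frame_base (hV : SmoothAt m φ V q) (hq : q ∈ (extChartAt (𝓡 m) p).source)
    (u : EuclideanSpace ℝ (Fin m)) :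
    coframe (φ q) (φ q) (covAlong h φ V q (frame p q u)) =
      fderiv ℝ (localSection m φ V p (φ q)) (extChartAt (𝓡 m) p q) u +
      localChristoffel h (φ q) (localMap m n φ p (φ q) (extChartAt (𝓡 m) p q))
        (fderiv ℝ (localMap m n φ p (φ q)) (extChartAt (𝓡 m) p q) u)
        (localSection m φ V p (φ q) (extChartAt (𝓡 m) p q)) := by
  have hy : φ q ∈ (extChartAt (𝓡 n) (φ q)).source := mem_extChartAt_source (φ q)
  rw [covAlong, map_add, coframe_christoffel, coframe_differential hq hy hV.mdifferentiableAt,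
    localMap_apply hq, localSection_apply hq, ← frameDeriv_frame hV hq, coframe_self]

/-- The Leibniz rule in coordinates, with `∂β` rewritten through Christoffel symbols. The target
chart `y` is arbitrary, so comparison with `dirDeriv_inner_eq` links the connection to every chart.
-/
theorem dirDeriv_inner (hV : SmoothAt m φ V q) (hW : SmoothAt m φ W q)
    (hq : q ∈ (extChartAt (𝓡 m) p).source) (hy : φ q ∈ (extChartAt (𝓡 n) y).source)
    (u : EuclideanSpace ℝ (Fin m)) :
    dirDeriv (fun r => h.inner (φ r) (V r) (W r)) q (frame p q u) =
      localMetric h y (extChartAt (𝓡 n) y (φ q))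
        (fderiv ℝ (localSection m φ V p y) (extChartAt (𝓡 m) p q) u +
          localChristoffel h y (extChartAt (𝓡 n) y (φ q))
            (fderiv ℝ (localMap m n φ p y) (extChartAt (𝓡 m) p q) u) (coframe y (φ q) (V q)))
        (coframe y (φ q) (W q)) +
      localMetric h y (extChartAt (𝓡 n) y (φ q)) (coframe y (φ q) (V q))
        (fderiv ℝ (localSection m φ W p y) (extChartAt (𝓡 m) p q) u +
          localChristoffel h y (extChartAt (𝓡 n) y (φ q))
            (fderiv ℝ (localMap m n φ p y) (extChartAt (𝓡 m) p q) u) (coframe y (φ q) (W q))) := by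
  rw [dirDeriv_frame hq ((contMDiffAt_inner hV hW).mdifferentiableAt (by simp))]
  have e : localFun m (fun r => h.inner (φ r) (V r) (W r)) p =ᶠ[𝓝 (extChartAt (𝓡 m) p q)]
      fun x => localMetric h y (localMap m n φ p y x) (localSection m φ V p y x)
        (localSection m φ W p y x) := by
    filter_upwards [eventually_chart hq (eventually_mem_source hV.base.continuousAt hy)]
      with x hx
    exact inner_eq_localMetric hx.2.2 _ _
  rw [e.fderiv_eq]
  have hψ := (contDiffAt_localMap le_rfl hq hy hV.base).differentiableAt (by simp)
  have hβ : DifferentiableAt ℝ (localMetric h y) (localMap m n φ p y (extChartAt (𝓡 m) p q)) := by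
    rw [localMap_apply hq]
    exact differentiableAt_localMetric hy
  have h1 := hβ.hasFDerivAt.comp _ hψ.hasFDerivAt
  rw [(hasFDerivAt_clm_apply₂ (B := fun x => localMetric h y (localMap m n φ p y x))
    h1.differentiableAt ((hV.contDiffAt hq hy).differentiableAt (by simp))
    ((hW.contDiffAt hq hy).differentiableAt (by simp)) u).2]
  have h2 : fderiv ℝ (fun x => localMetric h y (localMap m n φ p y x)) (extChartAt (𝓡 m) p q) u =
      fderiv ℝ (localMetric h y) (extChartAt (𝓡 n) y (φ q))
        (fderiv ℝ (localMap m n φ p y) (extChartAt (𝓡 m) p q) u) := by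
    rw [← localMap_apply hq]
    exact congrArg (fun L : EuclideanSpace ℝ (Fin m) →L[ℝ] _ => L u) h1.fderiv
  rw [h2, localSection_apply hq, localSection_apply hq, localMap_apply hq,
    fderiv_localMetric_eq hy]
  simp only [map_add, _root_.add_apply]
  ring

theorem exists_frame_eq (v : TangentSpace (𝓡 m) q) :
    ∃ u : EuclideanSpace ℝ (Fin m), frame q q u = v := ⟨_, frame_self (p := q) v⟩

/-- The pull-back connection is compatible with the metric. -/
theorem dirDeriv_inner_eq (hV : SmoothAt m φ V q) (hW : SmoothAt m φ W q)
    (v : TangentSpace (𝓡 m) q) :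
    dirDeriv (fun r => h.inner (φ r) (V r) (W r)) q v =
      h.inner (φ q) (covAlong h φ V q v) (W q) + h.inner (φ q) (V q) (covAlong h φ W q v) := by
  obtain ⟨u, rfl⟩ := exists_frame_eq v
  have hq := mem_extChartAt_source (I := 𝓡 m) q
  have hy : φ q ∈ (extChartAt (𝓡 n) (φ q)).source := mem_extChartAt_source (φ q)
  rw [dirDeriv_inner hV hW hq hy, inner_eq_localMetric hy, inner_eq_localMetric hy,
    covAlong_frame_base hV hq, covAlong_frame_base hW hq, localMap_apply hq,
    localSection_apply hq, localSection_apply hq]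

variable (m n) in
/-- The image under `dφ` of the coordinate field with coefficients `u` of the chart at `p`. -/
def pushField (φ : M → N) (p : M) (u : EuclideanSpace ℝ (Fin m)) (r : M) :
    TangentSpace (𝓡 n) (φ r) :=
  differential φ r (frame p r u)

theorem localSection_pushField (hφ : ContMDiff (𝓡 m) (𝓡 n) ∞ φ)
    (hq : q ∈ (extChartAt (𝓡 m) p).source) (hy : φ q ∈ (extChartAt (𝓡 n) y).source)
    (u : EuclideanSpace ℝ (Fin m)) :
    localSection m φ (pushField m n φ p u) p y =ᶠ[𝓝 (extChartAt (𝓡 m) p q)]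
      fun x => fderiv ℝ (localMap m n φ p y) x u := by
  filter_upwards [eventually_chart hq (eventually_mem_source hφ.continuous.continuousAt hy)]
    with x hx
  rw [localSection, pushField,
    coframe_differential hx.2.1 hx.2.2 (hφ.contMDiffAt.mdifferentiableAt (by simp)),
    (extChartAt (𝓡 m) p).right_inv hx.1]

theorem smoothAt_pushField (hφ : ContMDiff (𝓡 m) (𝓡 n) ∞ φ)
    (hq : q ∈ (extChartAt (𝓡 m) p).source) (u : EuclideanSpace ℝ (Fin m)) :
    SmoothAt m φ (pushField m n φ p u) q := by
  have hy : φ q ∈ (extChartAt (𝓡 n) (φ q)).source := mem_extChartAt_source (φ q)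
  refine smoothAt_of_contDiffAt hφ.contMDiffAt hq hy ?_
  refine ContDiffAt.congr_of_eventuallyEq ?_ (localSection_pushField hφ hq hy u)
  exact ((contDiffAt_localMap le_rfl hq hy hφ.contMDiffAt).fderiv_right (m := ∞)
    (by simp)).clm_apply contDiffAt_const

theorem fderiv_localSection_pushField (hφ : ContMDiff (𝓡 m) (𝓡 n) ∞ φ)
    (hq : q ∈ (extChartAt (𝓡 m) p).source) (hy : φ q ∈ (extChartAt (𝓡 n) y).source)
    (u v : EuclideanSpace ℝ (Fin m)) :
    fderiv ℝ (localSection m φ (pushField m n φ p u) p y) (extChartAt (𝓡 m) p q) v =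
      fderiv ℝ (fderiv ℝ (localMap m n φ p y)) (extChartAt (𝓡 m) p q) v u := by
  rw [(localSection_pushField hφ hq hy u).fderiv_eq]
  have hd : DifferentiableAt ℝ (fderiv ℝ (localMap m n φ p y)) (extChartAt (𝓡 m) p q) :=
    ((contDiffAt_localMap le_rfl hq hy hφ.contMDiffAt).fderiv_right (m := ∞)
      (by simp)).differentiableAt (by simp)
  rw [(hd.hasFDerivAt.clm_apply (hasFDerivAt_const u _)).fderiv]
  simp

theorem fderiv_fderiv_localMap_symm (hφ : ContMDiff (𝓡 m) (𝓡 n) ∞ φ)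
    (hq : q ∈ (extChartAt (𝓡 m) p).source) (hy : φ q ∈ (extChartAt (𝓡 n) y).source)
    (u v : EuclideanSpace ℝ (Fin m)) :
    fderiv ℝ (fderiv ℝ (localMap m n φ p y)) (extChartAt (𝓡 m) p q) u v =
      fderiv ℝ (fderiv ℝ (localMap m n φ p y)) (extChartAt (𝓡 m) p q) v u :=
  ((contDiffAt_localMap le_rfl hq hy hφ.contMDiffAt).isSymmSndFDerivAt
    (by simp only [minSmoothness_of_isRCLikeNormedField]; norm_cast)) u v

/-- The pull-back connection is torsion free. -/
theorem covAlong_pushField_symm (hφ : ContMDiff (𝓡 m) (𝓡 n) ∞ φ)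
    (hq : q ∈ (extChartAt (𝓡 m) p).source) (u v : EuclideanSpace ℝ (Fin m)) :
    covAlong h φ (pushField m n φ p u) q (frame p q v) =
      covAlong h φ (pushField m n φ p v) q (frame p q u) := by
  have hy : φ q ∈ (extChartAt (𝓡 n) (φ q)).source := mem_extChartAt_source (φ q)
  rw [← frame_coframe hy (covAlong h φ (pushField m n φ p u) q (frame p q v)),
    ← frame_coframe hy (covAlong h φ (pushField m n φ p v) q (frame p q u)),
    covAlong_frame_base (smoothAt_pushField hφ hq u) hq,
    covAlong_frame_base (smoothAt_pushField hφ hq v) hq,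
    fderiv_localSection_pushField hφ hq hy, fderiv_localSection_pushField hφ hq hy,
    fderiv_fderiv_localMap_symm hφ hq hy, (localSection_pushField hφ hq hy u).self_of_nhds,
    (localSection_pushField hφ hq hy v).self_of_nhds, localMap_apply hq, localChristoffel_symm hy]

/-- The Koszul formula for coordinate fields. -/
theorem inner_covAlong_pushField (hφ : ContMDiff (𝓡 m) (𝓡 n) ∞ φ)
    (hq : q ∈ (extChartAt (𝓡 m) p).source) (u v w : EuclideanSpace ℝ (Fin m)) :
    h.inner (φ q) (covAlong h φ (pushField m n φ p v) q (frame p q u)) (pushField m n φ p w q) =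
      (1 / 2 : ℝ) *
      (dirDeriv (fun r => h.inner (φ r) (pushField m n φ p v r) (pushField m n φ p w r)) q
          (frame p q u) +
        dirDeriv (fun r => h.inner (φ r) (pushField m n φ p u r) (pushField m n φ p w r)) q
          (frame p q v) -
        dirDeriv (fun r => h.inner (φ r) (pushField m n φ p u r) (pushField m n φ p v r)) q
          (frame p q w)) := by
  -- The usual Koszul cancellation: expand three derivatives by compatibility, then identify the
  -- mixed terms by vanishing torsion.
  have hs := fun u => smoothAt_pushField hφ hq u
  rw [dirDeriv_inner_eq (hs v) (hs w), dirDeriv_inner_eq (hs u) (hs w),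
    dirDeriv_inner_eq (hs u) (hs v), covAlong_pushField_symm hφ hq w v,
    covAlong_pushField_symm hφ hq w u, covAlong_pushField_symm hφ hq u v,
    h.symm _ (pushField m n φ p v q) (covAlong h φ _ q _),
    h.symm _ (pushField m n φ p u q) (covAlong h φ _ q _)]
  ring

theorem pushField_id (u : EuclideanSpace ℝ (Fin m)) (r : M) :
    pushField m m (fun r : M => r) p u r = frame p r u := differential_id _

/-- The Koszul formula for the identity map. It describes `∇` at every `q` in the domain of the
chart at `p`, whereas the definition refers to the chart at `q`. -/
theorem inner_nabla_frame {g : Metric m M} (hq : q ∈ (extChartAt (𝓡 m) p).source)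
    (u v w : EuclideanSpace ℝ (Fin m)) :
    g.inner q (nabla g (fun r => frame p r v) q (frame p q u)) (frame p q w) =
      koszulForm (localMetric g p) (extChartAt (𝓡 m) p q) u v w := by
  have := inner_covAlong_pushField (h := g) (φ := fun r : M => r) contMDiff_id hq u v w
  have e : ∀ u, pushField m m (fun r : M => r) p u = fun r => frame p r u :=
    fun u => funext (pushField_id u)
  simp only [e] at this
  rw [dirDeriv_inner_frame hq, dirDeriv_inner_frame hq, dirDeriv_inner_frame hq,
    ← koszulForm_apply] at this
  exact this

/-- Both connections are computed in the target chart at `φ q`, so the chain rule for the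
coefficients suffices. -/
theorem covAlong_comp {Z : Π z : N, TangentSpace (𝓡 n) z} (hφ : MDifferentiableAt (𝓡 m) (𝓡 n) φ q)
    (hZ : SmoothAt n (fun z : N => z) Z (φ q)) (v : TangentSpace (𝓡 m) q) :
    covAlong h φ (fun r => Z (φ r)) q v = nabla h Z (φ q) (differential φ q v) := by
  have hy : φ q ∈ (extChartAt (𝓡 n) (φ q)).source := mem_extChartAt_source (φ q)
  rw [nabla, covAlong, covAlong, differential_id]
  congr 1
  have hs := ((smoothAt_iff_of_mem (φ := fun z : N => z) hy).1 hZ).2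
  have hd : MDifferentiableAt (𝓡 n) 𝓘(ℝ, EuclideanSpace ℝ (Fin n))
      (coeffAlong (fun z : N => z) Z (φ q)) (φ q) := by
    refine (hs.mdifferentiableAt (by simp)).congr_of_eventuallyEq ?_
    filter_upwards [(isOpen_extChartAt_source (I := 𝓡 n) (φ q)).mem_nhds hy] with r hr
    exact trivializationAt_snd hr _
  exact dirDeriv_comp hd hφ v

/-- The pull-back connection in arbitrary charts. -/
theorem coframe_covAlong (hV : SmoothAt m φ V q) (hq : q ∈ (extChartAt (𝓡 m) p).source)
    (hy : φ q ∈ (extChartAt (𝓡 n) y).source) (u : EuclideanSpace ℝ (Fin m)) :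
    coframe y (φ q) (covAlong h φ V q (frame p q u)) =
      fderiv ℝ (localSection m φ V p y) (extChartAt (𝓡 m) p q) u +
      localChristoffel h y (extChartAt (𝓡 n) y (φ q))
        (fderiv ℝ (localMap m n φ p y) (extChartAt (𝓡 m) p q) u) (coframe y (φ q) (V q)) := by
  rw [← coframe_frame hy (fderiv ℝ _ _ _ + _)]
  congr 1
  refine eq_of_inner_eq (g := h) fun z => ?_
  obtain ⟨c, rfl⟩ : ∃ c, frame y (φ q) c = z := ⟨_, frame_coframe hy z⟩
  -- The test field has constant coefficients `c` in the chart at `y`. The derivative of `h(V, W)`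
  -- is computed intrinsically and in the chart; the terms with `∇W` agree by the Koszul formula, so
  -- the terms with `∇V` agree too.
  have hZ : SmoothAt n (fun z : N => z) (fun z => frame y z c) (φ q) :=
    smoothAt_coordField (v := c) hy
  have hW : SmoothAt m φ (fun r => frame y (φ r) c) q := by
    refine (smoothAt_iff_of_mem hy).2 ⟨hV.base, ?_⟩
    refine (contMDiffAt_const (c := c)).congr_of_eventuallyEq ?_
    filter_upwards [eventually_mem_source hV.base.continuousAt hy] with r hr
    exact coframe_frame hr c
  have hW' : fderiv ℝ (localSection m φ (fun r => frame y (φ r) c) p y)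
      (extChartAt (𝓡 m) p q) u = 0 := by
    have : localSection m φ (fun r => frame y (φ r) c) p y =ᶠ[𝓝 (extChartAt (𝓡 m) p q)]
        fun _ => c := by
      filter_upwards [eventually_chart hq (eventually_mem_source hV.base.continuousAt hy)]
        with x hx
      exact coframe_frame hx.2.2 c
    rw [this.fderiv_eq]
    simp
  have h1 := dirDeriv_inner_eq (h := h) hV hW (frame p q u)
  have h2 := dirDeriv_inner (h := h) hV hW hq hy u
  rw [h1, covAlong_comp hV.mdifferentiableAt hZ, hW', zero_add] at h2
  have h3 : h.inner (φ q) (V q) (nabla h (fun z => frame y z c) (φ q)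
      (differential φ q (frame p q u))) =
      localMetric h y (extChartAt (𝓡 n) y (φ q)) (coframe y (φ q) (V q))
        (localChristoffel h y (extChartAt (𝓡 n) y (φ q))
          (fderiv ℝ (localMap m n φ p y) (extChartAt (𝓡 m) p q) u) c) := by
    rw [h.symm, ← frame_coframe hy (V q), ← frame_coframe hy (differential φ q (frame p q u)),
      coframe_differential hq hy hV.mdifferentiableAt, inner_nabla_frame hy, coframe_frame hy,
      localMetric_symm]
    exact (christoffelForm_spec
      (isInvertible_localMetric ((extChartAt (𝓡 n) y).map_source hy)) _ _ _).symm
  rw [h3, coframe_frame hy, add_left_inj] at h2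
  rw [h2, inner_eq_localMetric hy, coframe_frame hy, coframe_frame hy]

end Along

/-! ### The curvature tensor in coordinates and its symmetries. -/

section Curvature

variable {n : ℕ} {N : Type*} [TopologicalSpace N] [ChartedSpace (EuclideanSpace ℝ (Fin n)) N]
  [IsManifold (𝓡 n) ∞ N] {h : Metric n N} {y z : N}

theorem localMap_id (hz : z ∈ (extChartAt (𝓡 n) y).source) :
    localMap n n (fun z : N => z) y y =ᶠ[𝓝 (extChartAt (𝓡 n) y z)] id := by
  filter_upwards [(isOpen_extChartAt_target (I := 𝓡 n) y).mem_nhds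
    ((extChartAt (𝓡 n) y).map_source hz)] with x hx
  exact (extChartAt (𝓡 n) y).right_inv hx

theorem coframe_nabla {Y : Π z : N, TangentSpace (𝓡 n) z}
    (hY : SmoothAt n (fun z : N => z) Y z) (hz : z ∈ (extChartAt (𝓡 n) y).source)
    (u : EuclideanSpace ℝ (Fin n)) :
    coframe y z (nabla h Y z (frame y z u)) =
      fderiv ℝ (localSection n (fun z : N => z) Y y y) (extChartAt (𝓡 n) y z) u +
      localChristoffel h y (extChartAt (𝓡 n) y z) u (coframe y z (Y z)) := by
  have := coframe_covAlong (h := h) (φ := fun z : N => z) hY hz hz u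
  rw [(localMap_id hz).fderiv_eq, fderiv_id] at this
  exact this

theorem localSection_frame (hz : z ∈ (extChartAt (𝓡 n) y).source)
    (v : EuclideanSpace ℝ (Fin n)) :
    localSection n (fun z : N => z) (fun z => frame y z v) y y =ᶠ[𝓝 (extChartAt (𝓡 n) y z)]
      fun _ => v := by
  filter_upwards [(isOpen_extChartAt_target (I := 𝓡 n) y).mem_nhds
    ((extChartAt (𝓡 n) y).map_source hz)] with x hx
  exact coframe_frame ((extChartAt (𝓡 n) y).map_target hx) v

theorem coframe_nabla_frame (hz : z ∈ (extChartAt (𝓡 n) y).source)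
    (u v : EuclideanSpace ℝ (Fin n)) :
    coframe y z (nabla h (fun z => frame y z v) z (frame y z u)) =
      localChristoffel h y (extChartAt (𝓡 n) y z) u v := by
  rw [coframe_nabla (Y := fun z => frame y z v) (smoothAt_coordField (v := v) hz) hz,
    (localSection_frame hz v).fderiv_eq,
    coframe_frame hz]
  simp

theorem localSection_nabla_frame (u v : EuclideanSpace ℝ (Fin n)) :
    localSection n (fun z : N => z) (fun z => nabla h (fun z => frame y z v) z (frame y z u)) y y
      =ᶠ[𝓝 (extChartAt (𝓡 n) y y)] fun x => localChristoffel h y x u v := by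
  filter_upwards [(isOpen_extChartAt_target (I := 𝓡 n) y).mem_nhds
    ((extChartAt (𝓡 n) y).map_source (mem_extChartAt_source y))] with x hx
  rw [localSection, coframe_nabla_frame ((extChartAt (𝓡 n) y).map_target hx),
    (extChartAt (𝓡 n) y).right_inv hx]

/-- The inner derivative is taken at varying points in the frame of one chart, so its coefficients
there are the functions `Γ(v, w)`, which can be differentiated. -/
theorem coframe_nabla_nabla_frame (u v w : EuclideanSpace ℝ (Fin n)) :
    coframe y y (nabla h (fun z => nabla h (fun z => frame y z w) z (frame y z v)) y
        (frame y y u)) =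
      fderiv ℝ (localChristoffel h y) (extChartAt (𝓡 n) y y) u v w +
      localChristoffel h y (extChartAt (𝓡 n) y y) u
        (localChristoffel h y (extChartAt (𝓡 n) y y) v w) := by
  have hy := mem_extChartAt_source (I := 𝓡 n) y
  have hΓ := contDiffAt_localChristoffel (h := h) hy
  have hs : SmoothAt n (fun z : N => z)
      (fun z => nabla h (fun z => frame y z w) z (frame y z v)) y := by
    refine smoothAt_of_contDiffAt contMDiffAt_id hy hy ?_
    refine ContDiffAt.congr_of_eventuallyEq ?_ (localSection_nabla_frame v w)
    exact (hΓ.clm_apply contDiffAt_const).clm_apply contDiffAt_const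
  rw [coframe_nabla hs hy, (localSection_nabla_frame v w).fderiv_eq, coframe_nabla_frame hy]
  have := (hasFDerivAt_clm_apply₂ (hΓ.differentiableAt (by simp)) (differentiableAt_const v)
    (differentiableAt_const w) u).2
  rw [this]
  simp

/-- Coordinate fields pull back to constant fields under the inverse chart, and constant fields
commute. -/
theorem mlieBracket_frame (u v : EuclideanSpace ℝ (Fin n)) :
    VectorField.mlieBracket (𝓡 n) (fun z => frame y z u) (fun z => frame y z v) y = 0 := by
  rw [VectorField.mlieBracket, VectorField.mlieBracketWithin_apply]
  have hc : ∀ u : EuclideanSpace ℝ (Fin n),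
      VectorField.mpullbackWithin 𝓘(ℝ, EuclideanSpace ℝ (Fin n)) (𝓡 n) (extChartAt (𝓡 n) y).symm
        (fun z => frame y z u) (Set.range (𝓡 n)) =ᶠ[𝓝 (extChartAt (𝓡 n) y y)] fun _ => u := by
    intro u
    filter_upwards [(isOpen_extChartAt_target (I := 𝓡 n) y).mem_nhds
      ((extChartAt (𝓡 n) y).map_source (mem_extChartAt_source y))] with x hx
    rw [VectorField.mpullbackWithin_apply, frame_eq_mfderiv ((extChartAt (𝓡 n) y).map_target hx),
      (extChartAt (𝓡 n) y).right_inv hx, modelWithCornersSelf_coe, Set.range_id,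
      mfderivWithin_univ]
    have hi := isInvertible_mfderivWithin_extChartAt_symm (I := 𝓡 n) hx
    rw [modelWithCornersSelf_coe, Set.range_id, mfderivWithin_univ] at hi
    exact hi.inverse_apply_self _
  have hs : (extChartAt (𝓡 n) y).symm ⁻¹' Set.univ ∩ Set.range (𝓡 n) = Set.univ := by simp
  have h0 : VectorField.lieBracket ℝ (fun _ : EuclideanSpace ℝ (Fin n) => u) (fun _ => v)
      (extChartAt (𝓡 n) y y) = 0 := by simp [VectorField.lieBracket_eq]
  rw [hs]
  refine (congrArg _ ?_).trans (map_zero _)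
  exact (congrFun VectorField.lieBracketWithin_univ _).trans
    ((Filter.EventuallyEq.lieBracket_vectorField_eq (𝕜 := ℝ) (hc u) (hc v)).trans h0)

theorem nabla_zero_right (Y : Π z : N, TangentSpace (𝓡 n) z)
    (hY : SmoothAt n (fun z : N => z) Y y) : nabla h Y y 0 = 0 := by
  have hy := mem_extChartAt_source (I := 𝓡 n) y
  have := coframe_nabla (h := h) hY hy 0
  rw [← frame_coframe hy (nabla h Y y 0)]
  simp only [map_zero, _root_.zero_apply, add_zero] at this
  rw [this, map_zero]

theorem coframe_injective {a b : TangentSpace (𝓡 n) y} (h : coframe y y a = coframe y y b) :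
    a = b := by
  have hy := mem_extChartAt_source (I := 𝓡 n) y
  rw [← frame_coframe hy a, h, frame_coframe hy]

/-- Coordinate fields commute, so only the two iterated derivatives contribute. Linearity of the
curvature in its arguments is read off from this formula. -/
theorem coframe_curvature (a b c : TangentSpace (𝓡 n) y) :
    coframe y y (curvature h y a b c) = curvatureForm (localChristoffel h y)
      (extChartAt (𝓡 n) y y) (coframe y y a) (coframe y y b) (coframe y y c) := by
  have hy := mem_extChartAt_source (I := 𝓡 n) y
  have e : ∀ a : TangentSpace (𝓡 n) y, coordField y a = fun z => frame y z (coframe y y a) :=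
    fun a => funext fun z => coordField_eq_frame a
  have h1 := coframe_nabla_nabla_frame (h := h) (y := y)
    (coframe y y a) (coframe y y b) (coframe y y c)
  have h2 := coframe_nabla_nabla_frame (h := h) (y := y)
    (coframe y y b) (coframe y y a) (coframe y y c)
  rw [frame_coframe hy] at h1 h2
  rw [curvature, e a, e b, e c, mlieBracket_frame,
    nabla_zero_right (fun z => frame y z _) (smoothAt_coordField (v := coframe y y c) hy),
    sub_zero, map_sub (coframe y y), h1, h2, curvatureForm]
  abel

theorem inner_curvature_antisymm (a b c d : TangentSpace (𝓡 n) y) :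
    h.inner y (curvature h y a b c) d = - h.inner y c (curvature h y a b d) := by
  have hy := mem_extChartAt_source (I := 𝓡 n) y
  have ht := (extChartAt (𝓡 n) y).map_source hy
  rw [eq_neg_iff_add_eq_zero, inner_eq_localMetric hy, inner_eq_localMetric hy,
    coframe_curvature, coframe_curvature]
  refine curvatureForm_antisymm (contDiffAt_localMetric ht) (fun _ _ _ => localMetric_symm _ _ _)
    ?_ _ _ _ _
  filter_upwards [(isOpen_extChartAt_target (I := 𝓡 n) y).mem_nhds ht] with x hx
  exact isInvertible_localMetric hx

theorem curvature_self (a c : TangentSpace (𝓡 n) y) : curvature h y a a c = 0 := by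
  apply coframe_injective
  rw [coframe_curvature, curvatureForm, map_zero]
  abel

theorem curvature_add_left (a a' b c : TangentSpace (𝓡 n) y) :
    curvature h y (a + a') b c = curvature h y a b c + curvature h y a' b c := by
  apply coframe_injective
  simp only [map_add, coframe_curvature, curvatureForm, _root_.add_apply]
  abel

theorem curvature_smul_left (r : ℝ) (a b c : TangentSpace (𝓡 n) y) :
    curvature h y (r • a) b c = r • curvature h y a b c := by
  apply coframe_injective
  simp only [map_smul, coframe_curvature, curvatureForm, _root_.smul_apply, smul_add, smul_sub]

theorem curvature_add_right (a b c c' : TangentSpace (𝓡 n) y) :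
    curvature h y a b (c + c') = curvature h y a b c + curvature h y a b c' := by
  apply coframe_injective
  simp only [map_add, coframe_curvature, curvatureForm]
  abel

theorem curvature_smul_right (r : ℝ) (a b c : TangentSpace (𝓡 n) y) :
    curvature h y a b (r • c) = r • curvature h y a b c := by
  apply coframe_injective
  simp only [map_smul, coframe_curvature, curvatureForm, smul_add, smul_sub]

theorem curvature_zero_middle (a c : TangentSpace (𝓡 n) y) : curvature h y a 0 c = 0 := by
  apply coframe_injective
  simp [coframe_curvature, curvatureForm]

end Curvature

/-! ### The second fundamental form in coordinates; smoothness of the tension field. -/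

section SecondFundamentalForm

variable {m n : ℕ}
  {M : Type*} [TopologicalSpace M] [ChartedSpace (EuclideanSpace ℝ (Fin m)) M]
  [IsManifold (𝓡 m) ∞ M]
  {N : Type*} [TopologicalSpace N] [ChartedSpace (EuclideanSpace ℝ (Fin n)) N]
  [IsManifold (𝓡 n) ∞ N] {g : Metric m M} {h : Metric n N} {φ : M → N} {p q : M} {y : N}
  {V W : Π q : M, TangentSpace (𝓡 n) (φ q)}

theorem coframe_covAlong_self (hV : SmoothAt m φ V q) (u : TangentSpace (𝓡 m) q) :
    coframe (φ q) (φ q) (covAlong h φ V q u) =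
      fderiv ℝ (localSection m φ V q (φ q)) (extChartAt (𝓡 m) q q) (coframe q q u) +
      localChristoffel h (φ q) (extChartAt (𝓡 n) (φ q) (φ q))
        (fderiv ℝ (localMap m n φ q (φ q)) (extChartAt (𝓡 m) q q) (coframe q q u))
        (coframe (φ q) (φ q) (V q)) := by
  have hq := mem_extChartAt_source (I := 𝓡 m) q
  rw [← coframe_covAlong hV hq (mem_extChartAt_source (I := 𝓡 n) (φ q)), frame_coframe hq]

theorem covAlong_smul_right (hV : SmoothAt m φ V q) (r : ℝ) (u : TangentSpace (𝓡 m) q) :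
    covAlong h φ V q (r • u) = r • covAlong h φ V q u := by
  apply coframe_injective
  simp only [map_smul, coframe_covAlong_self hV, _root_.smul_apply, smul_add]

theorem covAlong_zero_right (hV : SmoothAt m φ V q) :
    covAlong h φ V q (0 : TangentSpace (𝓡 m) q) = 0 := by
  simpa using covAlong_smul_right (h := h) hV 0 0

theorem differential_add (u v : TangentSpace (𝓡 m) q) :
    differential (n := n) φ q (u + v) =
      differential (n := n) φ q u + differential (n := n) φ q v :=
  map_add (mfderiv (𝓡 m) (𝓡 n) φ q) u v

theorem differential_smul (r : ℝ) (u : TangentSpace (𝓡 m) q) :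
    differential (n := n) φ q (r • u) = r • differential (n := n) φ q u :=
  map_smul (mfderiv (𝓡 m) (𝓡 n) φ q) r u

/-- The field extending the second vector belongs to the chart at `q`, and its coefficients in the
chart at `p` need not be constant. Their derivative enters both `∇^φ(dφ Y)` and `dφ(∇Y)` and
cancels. -/
theorem coframe_secondFundamentalForm (hφ : ContMDiff (𝓡 m) (𝓡 n) ∞ φ)
    (hq : q ∈ (extChartAt (𝓡 m) p).source) (hy : φ q ∈ (extChartAt (𝓡 n) y).source)
    (u v : EuclideanSpace ℝ (Fin m)) :
    coframe y (φ q) (secondFundamentalForm g h φ q (frame p q u) (frame p q v)) =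
      fderiv ℝ (fderiv ℝ (localMap m n φ p y)) (extChartAt (𝓡 m) p q) u v +
      localChristoffel h y (localMap m n φ p y (extChartAt (𝓡 m) p q))
        (fderiv ℝ (localMap m n φ p y) (extChartAt (𝓡 m) p q) u)
        (fderiv ℝ (localMap m n φ p y) (extChartAt (𝓡 m) p q) v) -
      fderiv ℝ (localMap m n φ p y) (extChartAt (𝓡 m) p q)
        (localChristoffel g p (extChartAt (𝓡 m) p q) u v) := by
  set Y := coordField q (frame p q v) with hYdef
  have hφd := hφ.mdifferentiable (by simp)
  have hYs : SmoothAt m (fun r : M => r) Y q := smoothAt_coordField (mem_extChartAt_source q)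
  have hYq : Y q = frame p q v := coordField_self _
  have hψ := contDiffAt_localMap (y := y) le_rfl hq hy hφ.contMDiffAt
  have hψ' : ContDiffAt ℝ ∞ (fderiv ℝ (localMap m n φ p y)) (extChartAt (𝓡 m) p q) :=
    hψ.fderiv_right (by simp)
  have hYl := hYs.contDiffAt hq hq
  have e : localSection m φ (fun r => differential φ r (Y r)) p y =ᶠ[𝓝 (extChartAt (𝓡 m) p q)]
      fun x => fderiv ℝ (localMap m n φ p y) x (localSection m (fun r : M => r) Y p p x) := by
    filter_upwards [eventually_chart hq (eventually_mem_source hφ.continuous.continuousAt hy)]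
      with x hx
    have := coframe_differential (φ := φ) hx.2.1 hx.2.2 (hφd _)
      (coframe p _ (Y ((extChartAt (𝓡 m) p).symm x)))
    rw [frame_coframe hx.2.1, (extChartAt (𝓡 m) p).right_inv hx.1] at this
    exact this
  have hs : SmoothAt m φ (fun r => differential φ r (Y r)) q :=
    smoothAt_of_contDiffAt hφ.contMDiffAt hq hy
      (ContDiffAt.congr_of_eventuallyEq (hψ'.clm_apply hYl) e)
  have hn := coframe_nabla (h := g) hYs hq u
  rw [hYq, coframe_frame hq] at hn
  have hcl : coframe p q (Y q) = v := by rw [hYq, coframe_frame hq]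
  rw [secondFundamentalForm, ← hYdef, map_sub, coframe_covAlong hs hq hy, e.fderiv_eq, hYq,
    coframe_differential hq hy (hφd _), localMap_apply hq,
    ← frame_coframe hq (nabla g Y q (frame p q u)), coframe_differential hq hy (hφd _), hn]
  have := ((hψ'.differentiableAt (by simp)).hasFDerivAt.clm_apply
    (hYl.differentiableAt (by simp)).hasFDerivAt).fderiv
  rw [this, localSection_apply hq, hcl]
  simp only [map_add, _root_.add_apply, ContinuousLinearMap.comp_apply,
    ContinuousLinearMap.flip_apply]
  abel

theorem coframe_secondFundamentalForm_self (hφ : ContMDiff (𝓡 m) (𝓡 n) ∞ φ)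
    (u v : TangentSpace (𝓡 m) q) :
    coframe (φ q) (φ q) (secondFundamentalForm g h φ q u v) =
      fderiv ℝ (fderiv ℝ (localMap m n φ q (φ q))) (extChartAt (𝓡 m) q q) (coframe q q u)
        (coframe q q v) +
      localChristoffel h (φ q) (localMap m n φ q (φ q) (extChartAt (𝓡 m) q q))
        (fderiv ℝ (localMap m n φ q (φ q)) (extChartAt (𝓡 m) q q) (coframe q q u))
        (fderiv ℝ (localMap m n φ q (φ q)) (extChartAt (𝓡 m) q q) (coframe q q v)) -
      fderiv ℝ (localMap m n φ q (φ q)) (extChartAt (𝓡 m) q q)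
        (localChristoffel g q (extChartAt (𝓡 m) q q) (coframe q q u) (coframe q q v)) := by
  have hq := mem_extChartAt_source (I := 𝓡 m) q
  rw [← coframe_secondFundamentalForm hφ hq (mem_extChartAt_source (I := 𝓡 n) (φ q)),
    frame_coframe hq, frame_coframe hq]

/-- The second fundamental form as a bilinear map. -/
def secondFundamentalFormₗ (g : Metric m M) (h : Metric n N) (hφ : ContMDiff (𝓡 m) (𝓡 n) ∞ φ)
    (q : M) :
    TangentSpace (𝓡 m) q →ₗ[ℝ] TangentSpace (𝓡 m) q →ₗ[ℝ] TangentSpace (𝓡 n) (φ q) :=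
  LinearMap.mk₂ ℝ (secondFundamentalForm g h φ q)
    (fun u u' v => by
      apply coframe_injective
      simp only [map_add, coframe_secondFundamentalForm_self hφ, _root_.add_apply]
      abel)
    (fun r u v => by
      apply coframe_injective
      simp only [map_smul, coframe_secondFundamentalForm_self hφ, _root_.smul_apply, smul_add,
        smul_sub])
    (fun u v v' => by
      apply coframe_injective
      simp only [map_add, coframe_secondFundamentalForm_self hφ]
      abel)
    (fun r u v => by
      apply coframe_injective
      simp only [map_smul, coframe_secondFundamentalForm_self hφ, smul_add, smul_sub])

/-- The dual family comes from applying the inverse metric to the coordinate functionals, a form in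
which it visibly depends smoothly on the point. -/
theorem isDualPair_frame (hq : q ∈ (extChartAt (𝓡 m) p).source) :
    IsDualPair g q (fun i => frame p q (EuclideanSpace.single i (1 : ℝ)))
      (fun i : Fin m => frame p q ((localMetric g p (extChartAt (𝓡 m) p q)).inverse
        (EuclideanSpace.proj i))) := by
  intro v
  have hi := isInvertible_localMetric (h := g) ((extChartAt (𝓡 m) p).map_source hq)
  obtain ⟨w, rfl⟩ : ∃ w, frame p q w = v := ⟨_, frame_coframe hq v⟩
  have : ∀ i : Fin m, g.inner q (frame p q w) (frame p q
      ((localMetric g p (extChartAt (𝓡 m) p q)).inverse (EuclideanSpace.proj i))) = w i := by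
    intro i
    rw [← localMetric_extChartAt hq, localMetric_symm, hi.self_apply_inverse]
    rfl
  simp only [this, ← map_smul, ← map_sum]
  congr 1
  have := (EuclideanSpace.basisFun (Fin m) ℝ).sum_repr w
  simpa using! this

/-- The definition changes chart from point to point. Computing the trace in the frame of one chart
yields an expression built from derivatives of `φ`, Christoffel symbols and the inverse metric, all
smooth. -/
theorem smoothAt_tension (hφ : ContMDiff (𝓡 m) (𝓡 n) ∞ φ) (p : M) :
    SmoothAt m φ (tension g h φ) p := by
  have hp := mem_extChartAt_source (I := 𝓡 m) p
  have hy : φ p ∈ (extChartAt (𝓡 n) (φ p)).source := mem_extChartAt_source (φ p)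
  refine smoothAt_of_contDiffAt hφ.contMDiffAt hp hy ?_
  have hψ := contDiffAt_localMap (y := φ p) le_rfl hp hy hφ.contMDiffAt
  have hψ' : ContDiffAt ℝ ∞ (fderiv ℝ (localMap m n φ p (φ p))) (extChartAt (𝓡 m) p p) :=
    hψ.fderiv_right (by simp)
  have hψ'' : ContDiffAt ℝ ∞ (fderiv ℝ (fderiv ℝ (localMap m n φ p (φ p))))
      (extChartAt (𝓡 m) p p) := hψ'.fderiv_right (by simp)
  have hinv : ∀ i : Fin m, ContDiffAt ℝ ∞ (fun x => (localMetric g p x).inverse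
      (EuclideanSpace.proj i)) (extChartAt (𝓡 m) p p) := by
    intro i
    have hi := isInvertible_localMetric (h := g) ((extChartAt (𝓡 m) p).map_source hp)
    have hm := contDiffAt_localMetric (h := g) ((extChartAt (𝓡 m) p).map_source hp)
    exact ((hi.contDiffAt_map_inverse (n := ∞)).comp (extChartAt (𝓡 m) p p) hm).clm_apply
      contDiffAt_const
  have hΓN : ContDiffAt ℝ ∞ (fun x => localChristoffel h (φ p) (localMap m n φ p (φ p) x))
      (extChartAt (𝓡 m) p p) := by
    have := contDiffAt_localChristoffel (h := h) hy
    rw [← localMap_apply hp] at this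
    exact this.comp _ hψ
  have hΓM := contDiffAt_localChristoffel (h := g) hp
  have e : localSection m φ (tension g h φ) p (φ p) =ᶠ[𝓝 (extChartAt (𝓡 m) p p)]
      fun x => ∑ i : Fin m,
        (fderiv ℝ (fderiv ℝ (localMap m n φ p (φ p))) x (EuclideanSpace.single i (1 : ℝ))
            ((localMetric g p x).inverse (EuclideanSpace.proj i)) +
          localChristoffel h (φ p) (localMap m n φ p (φ p) x)
            (fderiv ℝ (localMap m n φ p (φ p)) x (EuclideanSpace.single i (1 : ℝ)))
            (fderiv ℝ (localMap m n φ p (φ p)) x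
              ((localMetric g p x).inverse (EuclideanSpace.proj i))) -
          fderiv ℝ (localMap m n φ p (φ p)) x
            (localChristoffel g p x (EuclideanSpace.single i (1 : ℝ))
              ((localMetric g p x).inverse (EuclideanSpace.proj i)))) := by
    filter_upwards [eventually_chart hp (eventually_mem_source hφ.continuous.continuousAt hy)]
      with x hx
    have := metricTrace_eq_sum (isDualPair_frame (g := g) hx.2.1)
      (secondFundamentalFormₗ g h hφ ((extChartAt (𝓡 m) p).symm x))
    simp only [secondFundamentalFormₗ, LinearMap.mk₂_apply] at this
    rw [localSection, tension, this, map_sum]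
    refine Finset.sum_congr rfl fun i _ => ?_
    rw [coframe_secondFundamentalForm hφ hx.2.1 hx.2.2, (extChartAt (𝓡 m) p).right_inv hx.1]
  refine ContDiffAt.congr_of_eventuallyEq (ContDiffAt.sum fun i _ => ?_) e
  exact (((hψ''.clm_apply contDiffAt_const).clm_apply (hinv i)).add
    ((hΓN.clm_apply (hψ'.clm_apply contDiffAt_const)).clm_apply (hψ'.clm_apply (hinv i)))).sub
    (hψ'.clm_apply ((hΓM.clm_apply contDiffAt_const).clm_apply (hinv i)))

end SecondFundamentalForm

/-! ### Scalar multiples of sections along a map. -/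

section Sections

variable {m n : ℕ}
  {M : Type*} [TopologicalSpace M] [ChartedSpace (EuclideanSpace ℝ (Fin m)) M]
  [IsManifold (𝓡 m) ∞ M]
  {N : Type*} [TopologicalSpace N] [ChartedSpace (EuclideanSpace ℝ (Fin n)) N]
  [IsManifold (𝓡 n) ∞ N] {g : Metric m M} {h : Metric n N} {φ : M → N} {p q : M}
  {V W : Π q : M, TangentSpace (𝓡 n) (φ q)}

theorem SmoothAt.smul {f : M → ℝ} (hf : ContMDiffAt (𝓡 m) 𝓘(ℝ, ℝ) ∞ f q)
    (hV : SmoothAt m φ V q) : SmoothAt m φ (fun r => f r • V r) q := by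
  have hy : φ q ∈ (extChartAt (𝓡 n) (φ q)).source := mem_extChartAt_source (φ q)
  rw [smoothAt_iff_of_mem hy] at hV ⊢
  refine ⟨hV.1, ?_⟩
  simp only [map_smul]
  exact hf.smul hV.2

theorem covAlong_const_smul (hV : SmoothAt m φ V q) (c : ℝ) (u : TangentSpace (𝓡 m) q) :
    covAlong h φ (fun r => c • V r) q u = c • covAlong h φ V q u := by
  have hc : ContMDiffAt (𝓡 m) 𝓘(ℝ, ℝ) ∞ (fun _ : M => c) q := contMDiffAt_const
  have hd := (hV.contDiffAt (mem_extChartAt_source (I := 𝓡 m) q)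
    (mem_extChartAt_source (I := 𝓡 n) (φ q))).differentiableAt (by simp)
  have e : localSection m φ (fun r => c • V r) q (φ q) =
      fun x => c • localSection m φ V q (φ q) x := by
    funext x
    simp only [localSection, map_smul]
  apply coframe_injective
  rw [coframe_covAlong_self (hV.smul hc), e, map_smul, map_smul, map_smul,
    coframe_covAlong_self hV, fderiv_fun_const_smul hd, _root_.smul_apply, smul_add]

theorem covAlong_zero_left (hφ : ContMDiff (𝓡 m) (𝓡 n) ∞ φ) (u : TangentSpace (𝓡 m) q) :
    covAlong h φ (fun _ => 0) q u = 0 := by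
  have := covAlong_const_smul (h := h)
    (smoothAt_pushField hφ (mem_extChartAt_source (I := 𝓡 m) q) 0) 0 u
  simpa only [zero_smul] using this

end Sections

/-! ### Isometric immersions: the second fundamental form is normal. -/

section Isometric

variable {m n : ℕ}
  {M : Type*} [TopologicalSpace M] [ChartedSpace (EuclideanSpace ℝ (Fin m)) M]
  [IsManifold (𝓡 m) ∞ M]
  {N : Type*} [TopologicalSpace N] [ChartedSpace (EuclideanSpace ℝ (Fin n)) N]
  [IsManifold (𝓡 n) ∞ N] {g : Metric m M} {h : Metric n N} {φ : M → N} {p q : M}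
  {V W : Π q : M, TangentSpace (𝓡 n) (φ q)}

theorem coordField_eq_fun (v : TangentSpace (𝓡 m) p) :
    coordField p v = fun q => frame p q (coframe p p v) :=
  funext fun _ => coordField_eq_frame v

theorem secondFundamentalForm_eq (u v : TangentSpace (𝓡 m) p) :
    secondFundamentalForm g h φ p u v =
      covAlong h φ (pushField m n φ p (coframe p p v)) p u -
        differential φ p (nabla g (fun q => frame p q (coframe p p v)) p u) := by
  rw [secondFundamentalForm, coordField_eq_fun]
  rfl

/-- For an isometric immersion the Koszul formulas for `∇^φ(dφ Y)` and for `∇Y` have the same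
right-hand side, so the tangential parts coincide. -/
theorem inner_secondFundamentalForm_differential (hφ : IsIsometricImmersion g h φ)
    (u v w : TangentSpace (𝓡 m) p) :
    h.inner (φ p) (secondFundamentalForm g h φ p u v) (differential φ p w) = 0 := by
  have hp := mem_extChartAt_source (I := 𝓡 m) p
  obtain ⟨u, rfl⟩ := exists_frame_eq u
  obtain ⟨v, rfl⟩ := exists_frame_eq v
  obtain ⟨w, rfl⟩ := exists_frame_eq w
  have h1 := inner_covAlong_pushField (h := h) hφ.1 hp u v w
  simp only [pushField, hφ.2, dirDeriv_inner_frame hp] at h1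
  have h2 := inner_nabla_frame (g := g) hp u v w
  rw [koszulForm_apply, ← h1] at h2
  rw [secondFundamentalForm_eq, map_sub, _root_.sub_apply, coframe_frame hp, hφ.2, h2]
  exact sub_self _

/-- The Weingarten relation: differentiate `h(V, dφ Y) = 0`; the term `h(V, dφ(∇Y))` vanishes
because `V` is normal. -/
theorem inner_secondFundamentalForm_of_normal (hφ : IsIsometricImmersion g h φ)
    (hV : SmoothAt m φ V p)
    (hn : ∀ᶠ q in 𝓝 p, ∀ w : TangentSpace (𝓡 m) q, h.inner (φ q) (V q) (differential φ q w) = 0)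
    (u w : TangentSpace (𝓡 m) p) :
    h.inner (φ p) (covAlong h φ V p u) (differential φ p w) =
      - h.inner (φ p) (V p) (secondFundamentalForm g h φ p u w) := by
  have hp := mem_extChartAt_source (I := 𝓡 m) p
  have h1 := dirDeriv_inner_eq (h := h) hV (smoothAt_pushField hφ.1 hp (coframe p p w)) u
  have h2 : (fun q => h.inner (φ q) (V q) (pushField m n φ p (coframe p p w) q)) =ᶠ[𝓝 p]
      fun _ => 0 := by
    filter_upwards [hn] with q hq
    exact hq _
  rw [dirDeriv_congr h2, dirDeriv_const] at h1
  rw [secondFundamentalForm_eq, map_sub, hn.self_of_nhds, sub_zero]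
  rw [pushField, frame_coframe hp] at h1
  linarith

theorem tension_eq_sum (hφ : ContMDiff (𝓡 m) (𝓡 n) ∞ φ) :
    tension g h φ p =
      ∑ i, secondFundamentalForm g h φ p (coordBasis p i) (dualBasis g p i) :=
  metricTrace_eq_sum (isDualPair_coordBasis g p) (secondFundamentalFormₗ g h hφ p)

theorem inner_tension_differential (hφ : IsIsometricImmersion g h φ)
    (w : TangentSpace (𝓡 m) p) :
    h.inner (φ p) (tension g h φ p) (differential φ p w) = 0 := by
  rw [tension_eq_sum hφ.1, map_sum, _root_.sum_apply]
  exact Finset.sum_eq_zero fun i _ => inner_secondFundamentalForm_differential hφ _ _ _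

theorem inner_shapeOperator (hφ : ContMDiff (𝓡 m) (𝓡 n) ∞ φ) (ν : TangentSpace (𝓡 n) (φ p))
    (u v : TangentSpace (𝓡 m) p) :
    g.inner p (shapeOperator g h φ p ν u) v =
      h.inner (φ p) (secondFundamentalForm g h φ p u v) ν := by
  rw [h.symm]
  have := inner_sharp (g := g) (((h.inner (φ p) ν).toLinearMap).comp
    (secondFundamentalFormₗ g h hφ p u)) v
  refine Eq.trans ?_ this
  congr 2
  rw [shapeOperator]
  congr 1
  funext v
  exact h.symm _ _ _

theorem meanCurvature_eq (hφ : ContMDiff (𝓡 m) (𝓡 n) ∞ φ) (ν : TangentSpace (𝓡 n) (φ p)) :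
    meanCurvature g h φ p ν = (1 / (m : ℝ)) * h.inner (φ p) (tension g h φ p) ν := by
  rw [meanCurvature]
  congr 1
  simp only [inner_shapeOperator hφ, tension, metricTrace, map_sum, map_smul, _root_.sum_apply,
    _root_.smul_apply]

end Isometric

/-! ### Codimension one: unit normals, adapted frames, umbilicity. -/

section Hypersurface

variable {m : ℕ}
  {M : Type*} [TopologicalSpace M] [ChartedSpace (EuclideanSpace ℝ (Fin m)) M]
  [IsManifold (𝓡 m) ∞ M]
  {N : Type*} [TopologicalSpace N] [ChartedSpace (EuclideanSpace ℝ (Fin (m + 1))) N]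
  [IsManifold (𝓡 (m + 1)) ∞ N] {g : Metric m M} {h : Metric (m + 1) N} {φ : M → N} {p q : M}

theorem finrank_tangentSpace : Module.finrank ℝ (TangentSpace (𝓡 m) p) = m :=
  finrank_euclideanSpace_fin (𝕜 := ℝ) (n := m)

instance : FiniteDimensional ℝ (TangentSpace (𝓡 m) p) :=
  inferInstanceAs (FiniteDimensional ℝ (EuclideanSpace ℝ (Fin m)))

variable (m) in
/-- The differential of a map as a linear map. -/
def differentialₗ (φ : M → N) (p : M) :
    TangentSpace (𝓡 m) p →ₗ[ℝ] TangentSpace (𝓡 (m + 1)) (φ p) :=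
  (mfderiv (𝓡 m) (𝓡 (m + 1)) φ p).toLinearMap

theorem differentialₗ_apply (v : TangentSpace (𝓡 m) p) :
    differentialₗ m φ p v = differential (n := m + 1) φ p v := rfl

/-- Orthogonality to the image of `dφ` is `m` linear conditions in dimension `m + 1`, so there is a
nonzero solution to normalise. -/
theorem exists_isUnitNormal (h : Metric (m + 1) N) (φ : M → N) (p : M) :
    ∃ ν, IsUnitNormal (m := m) h φ p ν := by
  set Φ : TangentSpace (𝓡 (m + 1)) (φ p) →ₗ[ℝ] Fin m → ℝ :=
    LinearMap.pi fun i => (h.inner (φ p) (differentialₗ m φ p (coordBasis p i))).toLinearMap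
  have hk : LinearMap.ker Φ ≠ ⊥ := by
    refine LinearMap.ker_ne_bot_of_finrank_lt ?_
    rw [finrank_tangentSpace, Module.finrank_fin_fun]
    exact Nat.lt_succ_self m
  obtain ⟨w, hw, hw0⟩ := (Submodule.ne_bot_iff _).1 hk
  have hpos := h.pos (φ p) w hw0
  have hn : ∀ v : TangentSpace (𝓡 m) p, h.inner (φ p) (differential φ p v) w = 0 := by
    intro v
    have hi : ∀ i, h.inner (φ p) (differentialₗ m φ p (coordBasis p i)) w = 0 :=
      fun i => congrFun (LinearMap.mem_ker.1 hw) i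
    rw [← differentialₗ_apply, ← sum_coordBasis p v, map_sum, map_sum, _root_.sum_apply]
    refine Finset.sum_eq_zero fun i _ => ?_
    rw [map_smul, map_smul, _root_.smul_apply, hi, smul_zero]
  refine ⟨(√(h.inner (φ p) w w))⁻¹ • w, ?_, fun v => ?_⟩
  · rw [map_smul, map_smul, _root_.smul_apply, smul_eq_mul, smul_eq_mul]
    have h1 := Real.mul_self_sqrt hpos.le
    have h2 := (Real.sqrt_pos.2 hpos).ne'
    field_simp
    rw [sq, h1]
  · rw [map_smul, hn, smul_zero]

theorem eq_zero_of_inner_eq_zero (hφ : IsIsometricImmersion g h φ)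
    {ν w : TangentSpace (𝓡 (m + 1)) (φ p)} (hν0 : ν ≠ 0)
    (hν : ∀ v : TangentSpace (𝓡 m) p, h.inner (φ p) ν (differential φ p v) = 0)
    (hw : ∀ v : TangentSpace (𝓡 m) p, h.inner (φ p) w (differential φ p v) = 0)
    (hwν : h.inner (φ p) w ν = 0) : w = 0 := by
  have hpos := h.pos (φ p) ν hν0
  -- `(v, t) ↦ dφ v + t ν` is injective, hence bijective by dimension; a vector orthogonal to its
  -- range is orthogonal to itself.
  set Ψ : TangentSpace (𝓡 m) p × ℝ →ₗ[ℝ] TangentSpace (𝓡 (m + 1)) (φ p) :=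
    (differentialₗ m φ p).coprod (LinearMap.toSpanSingleton ℝ _ ν) with hΨ
  have happ : ∀ x, Ψ x = differential φ p x.1 + x.2 • ν := fun x => rfl
  have hi : Function.Injective Ψ := by
    rw [injective_iff_map_eq_zero]
    rintro ⟨v, t⟩ hx
    rw [happ] at hx
    have h1 : t = 0 := by
      have := congrArg (fun z => h.inner (φ p) ν z) hx
      simp only [map_add, map_smul, hν, zero_add, map_zero, smul_eq_mul, mul_eq_zero,
        hpos.ne', or_false] at this
      exact this
    have h2 : g.inner p v v = 0 := by
      have := congrArg (fun z => h.inner (φ p) (differential φ p v) z) hx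
      simpa only [map_add, h1, zero_smul, map_zero, add_zero, hφ.2] using this
    rw [(inner_self_eq_zero_iff g p).1 h2, h1]
    rfl
  have hs : Function.Surjective Ψ := by
    rw [← LinearMap.injective_iff_surjective_of_finrank_eq_finrank]
    · exact hi
    · rw [Module.finrank_prod, finrank_tangentSpace, finrank_tangentSpace, Module.finrank_self]
  obtain ⟨⟨v, t⟩, hx⟩ := hs w
  rw [happ] at hx
  rw [← inner_self_eq_zero_iff h]
  nth_rewrite 2 [← hx]
  rw [map_add, map_smul, hw, hwν, smul_zero, add_zero]

theorem isDualPair_adapted (hφ : IsIsometricImmersion g h φ)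
    {ν : TangentSpace (𝓡 (m + 1)) (φ p)} (hν1 : h.inner (φ p) ν ν = 1)
    (hν : ∀ v : TangentSpace (𝓡 m) p, h.inner (φ p) ν (differential φ p v) = 0) :
    IsDualPair h (φ p)
      (fun i : Option (Fin m) => i.elim ν fun i => differential φ p (coordBasis p i))
      (fun i : Option (Fin m) => i.elim ν fun i => differential φ p (dualBasis g p i)) := by
  intro w
  rw [Fintype.sum_option, eq_comm, ← sub_eq_zero]
  simp only [Option.elim_none, Option.elim_some]
  refine eq_zero_of_inner_eq_zero hφ (ν := ν) ?_ hν (fun v => ?_) ?_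
  · rintro rfl
    simp at hν1
  · rw [map_sub, map_add, map_smul, map_sum, _root_.sub_apply, _root_.add_apply,
      _root_.smul_apply, _root_.sum_apply, hν, smul_zero, zero_add, sub_eq_zero]
    conv_lhs => rw [← (isDualPair_coordBasis g p).symm v, ← differentialₗ_apply, map_sum, map_sum]
    refine Finset.sum_congr rfl fun i _ => ?_
    rw [map_smul, map_smul, map_smul, _root_.smul_apply, hφ.2, smul_eq_mul, smul_eq_mul, mul_comm,
      g.symm p v]
    rfl
  · rw [map_sub, map_add, map_smul, map_sum, _root_.sub_apply, _root_.add_apply,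
      _root_.smul_apply, _root_.sum_apply, hν1, smul_eq_mul, mul_one, sub_eq_zero, eq_comm,
      add_eq_left]
    refine Finset.sum_eq_zero fun i _ => ?_
    rw [map_smul, _root_.smul_apply, h.symm _ _ ν, hν, smul_zero]

/-- A totally umbilical hypersurface has second fundamental form `g ⊗ τ / m`. -/
theorem secondFundamentalForm_eq_of_umbilical (hφ : IsIsometricImmersion g h φ)
    (hM : IsTotallyUmbilical g h φ) (u v : TangentSpace (𝓡 m) p) :
    secondFundamentalForm g h φ p u v =
      ((1 / (m : ℝ)) * g.inner p u v) • tension g h φ p := by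
  obtain ⟨ν, hν⟩ := exists_isUnitNormal (m := m) h φ p
  have hν' : ∀ v : TangentSpace (𝓡 m) p, h.inner (φ p) ν (differential φ p v) = 0 :=
    fun v => by rw [h.symm, hν.2]
  rw [← sub_eq_zero]
  refine eq_zero_of_inner_eq_zero hφ (ν := ν) ?_ hν' (fun w => ?_) ?_
  · rintro rfl
    simpa using hν.1
  · rw [map_sub, map_smul, _root_.sub_apply, _root_.smul_apply,
      inner_secondFundamentalForm_differential hφ, inner_tension_differential hφ, smul_zero,
      sub_zero]
  · have h1 := inner_shapeOperator (g := g) (h := h) hφ.1 ν u v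
    rw [hM p ν hν, meanCurvature_eq hφ.1, map_smul, _root_.smul_apply, smul_eq_mul] at h1
    rw [map_sub, map_smul, _root_.sub_apply, _root_.smul_apply, ← h1, smul_eq_mul]
    ring

/-- The covariant derivative of a normal field of a totally umbilical hypersurface. -/
theorem covAlong_normal (hφ : IsIsometricImmersion g h φ)
    (hM : IsTotallyUmbilical g h φ) {V : Π q : M, TangentSpace (𝓡 (m + 1)) (φ q)}
    (hV : SmoothAt m φ V p) (hV0 : V p ≠ 0)
    (hn : ∀ᶠ q in 𝓝 p, ∀ w : TangentSpace (𝓡 m) q, h.inner (φ q) (V q) (differential φ q w) = 0)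
    (u : TangentSpace (𝓡 m) p)
    (hc : dirDeriv (fun q => h.inner (φ q) (V q) (V q)) p u = 0) :
    covAlong h φ V p u =
      (-((1 / (m : ℝ)) * h.inner (φ p) (V p) (tension g h φ p))) • differential φ p u := by
  rw [← sub_eq_zero]
  -- Tangentially the claim is the Weingarten relation with umbilicity; in the normal direction,
  -- `∇V` is orthogonal to `V` because the length of `V` is stationary along `u`.
  refine eq_zero_of_inner_eq_zero hφ hV0 hn.self_of_nhds (fun w => ?_) ?_
  · rw [map_sub, map_smul, _root_.sub_apply, _root_.smul_apply,
      inner_secondFundamentalForm_of_normal hφ hV hn, hφ.2,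
      secondFundamentalForm_eq_of_umbilical hφ hM, map_smul, smul_eq_mul, smul_eq_mul]
    ring
  · rw [dirDeriv_inner_eq hV hV, h.symm _ (V p)] at hc
    rw [map_sub, map_smul, _root_.sub_apply, _root_.smul_apply, h.symm _ (differential φ p u),
      hn.self_of_nhds, smul_zero, sub_zero]
    linarith

end Hypersurface

/-! ### The Codazzi equation in coordinates. -/

section Euclidean

variable {E F : Type*} [NormedAddCommGroup E] [NormedSpace ℝ E] [NormedAddCommGroup F]
  [NormedSpace ℝ F]

/-- The Codazzi equation for a section `ν` along `ψ` with `∇ν = -k dψ`. -/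
theorem curvatureForm_of_fderiv_eq {Γ : F → F →L[ℝ] F →L[ℝ] F} {ψ ν : E → F} {k : E → ℝ} {x : E}
    (hΓ : DifferentiableAt ℝ Γ (ψ x)) (hs : ∀ a b, Γ (ψ x) a b = Γ (ψ x) b a)
    (hψ : ContDiffAt ℝ 2 ψ x) (hν : ContDiffAt ℝ 2 ν x) (hk : DifferentiableAt ℝ k x)
    (he : ∀ᶠ z in 𝓝 x, ∀ v, fderiv ℝ ν z v + Γ (ψ z) (fderiv ℝ ψ z v) (ν z) =
      (-k z) • fderiv ℝ ψ z v) (u v : E) :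
    curvatureForm Γ (ψ x) (fderiv ℝ ψ x u) (fderiv ℝ ψ x v) (ν x) =
      fderiv ℝ k x v • fderiv ℝ ψ x u - fderiv ℝ k x u • fderiv ℝ ψ x v := by
  have hψd : DifferentiableAt ℝ ψ x := hψ.differentiableAt (by simp)
  have hνd : DifferentiableAt ℝ ν x := hν.differentiableAt (by simp)
  have hψ' : DifferentiableAt ℝ (fderiv ℝ ψ) x :=
    (hψ.fderiv_right (m := 1) (by norm_num)).differentiableAt (by simp)
  have hν' : DifferentiableAt ℝ (fderiv ℝ ν) x :=
    (hν.fderiv_right (m := 1) (by norm_num)).differentiableAt (by simp)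
  have hψs : ∀ a b : E, fderiv ℝ (fderiv ℝ ψ) x a b = fderiv ℝ (fderiv ℝ ψ) x b a :=
    hψ.isSymmSndFDerivAt (by simp)
  have hνs : ∀ a b : E, fderiv ℝ (fderiv ℝ ν) x a b = fderiv ℝ (fderiv ℝ ν) x b a :=
    hν.isSymmSndFDerivAt (by simp)
  have hB : DifferentiableAt ℝ (fun z => Γ (ψ z)) x := hΓ.comp x hψd
  have hBd : ∀ a, fderiv ℝ (fun z => Γ (ψ z)) x a = fderiv ℝ Γ (ψ x) (fderiv ℝ ψ x a) := by
    intro a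
    have := (hΓ.hasFDerivAt.comp x hψd.hasFDerivAt).fderiv
    exact congrArg (fun L : E →L[ℝ] F →L[ℝ] F →L[ℝ] F => L a) this
  -- This is `he` in direction `b`, differentiated along `a`. In `key u v - key v u` the second
  -- derivatives cancel; substituting `he` for `∂ν` produces the quadratic terms of the curvature,
  -- and its `k`-terms cancel by symmetry of `Γ`.
  have key : ∀ a b : E, fderiv ℝ (fderiv ℝ ν) x a b +
      (fderiv ℝ Γ (ψ x) (fderiv ℝ ψ x a) (fderiv ℝ ψ x b) (ν x) +
        Γ (ψ x) (fderiv ℝ (fderiv ℝ ψ) x a b) (ν x) +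
        Γ (ψ x) (fderiv ℝ ψ x b) (fderiv ℝ ν x a)) =
      (-k x) • fderiv ℝ (fderiv ℝ ψ) x a b - fderiv ℝ k x a • fderiv ℝ ψ x b := by
    intro a b
    have h1 := (hν'.hasFDerivAt.clm_apply (hasFDerivAt_const b x))
    have h2 := (hψ'.hasFDerivAt.clm_apply (hasFDerivAt_const b x))
    have h3 := hasFDerivAt_clm_apply₂ hB h2.differentiableAt hνd a
    have h4 := h1.add h3.1.hasFDerivAt
    have h5 := hk.hasFDerivAt.neg.smul h2
    have h6 := h4.unique (h5.congr_of_eventuallyEq (he.mono fun z hz => hz b))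
    have h7 := congrArg (fun L : E →L[ℝ] F => L a) h6
    simp only [_root_.add_apply] at h7
    rw [h3.2, h2.fderiv, hBd] at h7
    simpa [sub_eq_add_neg] using h7
  have h0 := he.self_of_nhds
  have hu : fderiv ℝ ν x u = (-k x) • fderiv ℝ ψ x u - Γ (ψ x) (fderiv ℝ ψ x u) (ν x) :=
    eq_sub_of_add_eq (h0 u)
  have hv : fderiv ℝ ν x v = (-k x) • fderiv ℝ ψ x v - Γ (ψ x) (fderiv ℝ ψ x v) (ν x) :=
    eq_sub_of_add_eq (h0 v)
  have k1 := key u v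
  have k2 := key v u
  rw [hu, map_sub, map_smul] at k1
  rw [hv, map_sub, map_smul, hνs v u, hψs v u, hs (fderiv ℝ ψ x u) (fderiv ℝ ψ x v)] at k2
  have k3 := congrArg₂ (fun a b : F => a - b) k1 k2
  rw [curvatureForm]
  rw [← sub_eq_zero] at k3 ⊢
  rw [← k3]
  abel

end Euclidean

/-! ### The Codazzi equation on manifolds. -/

section Curvature

variable {m n : ℕ}
  {M : Type*} [TopologicalSpace M] [ChartedSpace (EuclideanSpace ℝ (Fin m)) M]
  [IsManifold (𝓡 m) ∞ M]
  {N : Type*} [TopologicalSpace N] [ChartedSpace (EuclideanSpace ℝ (Fin n)) N]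
  [IsManifold (𝓡 n) ∞ N] {h : Metric n N} {φ : M → N} {p : M}
  {V : Π q : M, TangentSpace (𝓡 n) (φ q)}

theorem curvature_of_covAlong_eq (hφ : ContMDiff (𝓡 m) (𝓡 n) ∞ φ)
    (hV : ∀ᶠ q in 𝓝 p, SmoothAt m φ V q) {k : M → ℝ}
    (hk : MDifferentiableAt (𝓡 m) 𝓘(ℝ, ℝ) k p)
    (he : ∀ᶠ q in 𝓝 p, ∀ u : TangentSpace (𝓡 m) q,
      covAlong h φ V q u = (-k q) • differential φ q u) (u v : TangentSpace (𝓡 m) p) :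
    curvature h (φ p) (differential φ p u) (differential φ p v) (V p) =
      dirDeriv k p v • differential φ p u - dirDeriv k p u • differential φ p v := by
  have hp := mem_extChartAt_source (I := 𝓡 m) p
  have hy : φ p ∈ (extChartAt (𝓡 n) (φ p)).source := mem_extChartAt_source (φ p)
  have hd : ∀ q, MDifferentiableAt (𝓡 m) (𝓡 n) φ q :=
    fun q => (hφ q).mdifferentiableAt (by simp)
  obtain ⟨u, rfl⟩ := exists_frame_eq u
  obtain ⟨v, rfl⟩ := exists_frame_eq v
  have hψ := contDiffAt_localMap (y := φ p) le_rfl hp hy hφ.contMDiffAt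
  have hν := hV.self_of_nhds.contDiffAt hp hy
  have hkd : DifferentiableAt ℝ (localFun m k p) (extChartAt (𝓡 m) p p) := by
    rw [← mdifferentiableAt_iff_differentiableAt]
    exact MDifferentiableAt.comp_of_eq (I' := 𝓡 m) (y := p) (x := extChartAt (𝓡 m) p p) (g := k)
      (hg := hk) (hf := mdifferentiableAt_extChartAt_symm ((extChartAt (𝓡 m) p).map_source hp))
      (hy := (extChartAt (𝓡 m) p).left_inv hp)
  have hψx := localMap_apply (n := n) (φ := φ) (y := φ p) hp
  have key := curvatureForm_of_fderiv_eq (Γ := localChristoffel h (φ p)) (k := localFun m k p)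
    (x := extChartAt (𝓡 m) p p) (ψ := localMap m n φ p (φ p))
    (ν := localSection m φ V p (φ p))
    (by rw [hψx]; exact (contDiffAt_localChristoffel hy).differentiableAt (by simp))
    (by rw [hψx]; exact localChristoffel_symm hy)
    (hψ.of_le (by norm_cast)) (hν.of_le (by norm_cast)) hkd
    (by
      filter_upwards [eventually_chart hp
        ((hV.and he).and (eventually_mem_source hφ.continuous.continuousAt hy))] with x hx w
      obtain ⟨hx1, hx2, ⟨hxV, hxe⟩, hxy⟩ := hx
      have h1 := coframe_covAlong (h := h) hxV hx2 hxy w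
      rw [hxe, map_smul, coframe_differential hx2 hxy (hd _),
        (extChartAt (𝓡 m) p).right_inv hx1] at h1
      exact h1.symm) u v
  apply coframe_injective
  rw [coframe_curvature, map_sub, map_smul, map_smul, coframe_differential hp hy (hd _),
    coframe_differential hp hy (hd _), dirDeriv_frame hp hk, dirDeriv_frame hp hk, ← hψx,
    ← localSection_apply hp, key]

end Curvature

/-! ### Functions with vanishing differential. -/

section Constant

variable {m : ℕ} {M : Type*} [TopologicalSpace M] [ChartedSpace (EuclideanSpace ℝ (Fin m)) M]
  [IsManifold (𝓡 m) ∞ M] {f : M → ℝ}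

theorem dirDeriv_eq_zero_of_isLocalMin {p : M} (hf : MDifferentiableAt (𝓡 m) 𝓘(ℝ, ℝ) f p)
    (hm : IsLocalMin f p) (v : TangentSpace (𝓡 m) p) : dirDeriv f p v = 0 := by
  have hp := mem_extChartAt_source (I := 𝓡 m) p
  obtain ⟨v, rfl⟩ := exists_frame_eq v
  have : IsLocalMin (localFun m f p) (extChartAt (𝓡 m) p p) := by
    filter_upwards [eventually_chart hp hm] with x hx
    rw [localFun_apply hp]
    exact hx.2.2
  rw [dirDeriv_frame hp hf, this.fderiv_eq_zero, _root_.zero_apply]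

/-- The chart image contains a ball around the image of each point, and a vanishing derivative on a
ball forces constancy. -/
theorem isLocallyConstant_of_dirDeriv_eq_zero (hf : MDifferentiable (𝓡 m) 𝓘(ℝ, ℝ) f)
    (h0 : ∀ (p : M) (v : TangentSpace (𝓡 m) p), dirDeriv f p v = 0) : IsLocallyConstant f := by
  rw [IsLocallyConstant.iff_eventually_eq]
  intro p
  have hp := mem_extChartAt_source (I := 𝓡 m) p
  have hx := (extChartAt (𝓡 m) p).map_source hp
  obtain ⟨r, hr, hb⟩ := Metric.isOpen_iff.1 (isOpen_extChartAt_target (I := 𝓡 m) p) _ hx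
  have hd : ∀ x ∈ (extChartAt (𝓡 m) p).target, DifferentiableAt ℝ (localFun m f p) x ∧
      fderiv ℝ (localFun m f p) x = 0 := by
    intro x hx
    refine ⟨?_, ?_⟩
    · rw [← mdifferentiableAt_iff_differentiableAt]
      exact MDifferentiableAt.comp x (hf _) (mdifferentiableAt_extChartAt_symm hx)
    · ext u
      have := dirDeriv_frame ((extChartAt (𝓡 m) p).map_target hx) (hf _) u
      rw [h0, (extChartAt (𝓡 m) p).right_inv hx] at this
      exact this.symm
  have hc : ∀ x ∈ Metric.ball (extChartAt (𝓡 m) p p) r,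
      localFun m f p x = localFun m f p (extChartAt (𝓡 m) p p) := fun x hx' =>
    Metric.isOpen_ball.is_const_of_fderiv_eq_zero (convex_ball _ _).isPreconnected
      (fun z hz => (hd z (hb hz)).1.differentiableWithinAt) (fun z hz => (hd z (hb hz)).2) hx'
      (Metric.mem_ball_self hr)
  filter_upwards [(isOpen_extChartAt_source (I := 𝓡 m) p).mem_nhds hp,
    (continuousAt_extChartAt (I := 𝓡 m) p).preimage_mem_nhds (Metric.ball_mem_nhds _ hr)]
    with q hq hq'
  rw [← localFun_apply (f := f) hq, ← localFun_apply (f := f) hp]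
  exact hc _ hq'

theorem exists_eq_const_of_dirDeriv_eq_zero [ConnectedSpace M]
    (hf : MDifferentiable (𝓡 m) 𝓘(ℝ, ℝ) f)
    (h0 : ∀ (p : M) (v : TangentSpace (𝓡 m) p), dirDeriv f p v = 0) : ∃ c, f = fun _ => c := by
  obtain ⟨p⟩ := (inferInstance : Nonempty M)
  exact ⟨f p, funext fun q =>
    (isLocallyConstant_of_dirDeriv_eq_zero hf h0).apply_eq_of_preconnectedSpace q p⟩

end Constant

/-! ### Gradient, Laplacian and Ricci curvature. -/

section Functions

variable {m : ℕ} {M : Type*} [TopologicalSpace M] [ChartedSpace (EuclideanSpace ℝ (Fin m)) M]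
  [IsManifold (𝓡 m) ∞ M] {f : M → ℝ} {p : M} {g : Metric m M}

theorem dirDeriv_real_comp {F : ℝ → ℝ} (hF : DifferentiableAt ℝ F (f p))
    (hf : MDifferentiableAt (𝓡 m) 𝓘(ℝ, ℝ) f p) {v : TangentSpace (𝓡 m) p}
    (h0 : dirDeriv f p v = 0) : dirDeriv (fun q => F (f q)) p v = 0 := by
  have h1 := mfderiv_comp (I := 𝓡 m) (I' := 𝓘(ℝ, ℝ)) (I'' := 𝓘(ℝ, ℝ)) p
    hF.mdifferentiableAt hf
  rw [mfderiv_eq_fderiv] at h1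
  have h2 : dirDeriv (fun q => F (f q)) p v = fderiv ℝ F (f p) (dirDeriv f p v) :=
    congrArg (fun L : EuclideanSpace ℝ (Fin m) →L[ℝ] ℝ => L v) h1
  rw [h2, h0, map_zero]

theorem inner_grad (v : TangentSpace (𝓡 m) p) : g.inner p (grad g f p) v = dirDeriv f p v :=
  inner_sharp (g := g) (mfderiv (𝓡 m) 𝓘(ℝ, ℝ) f p).toLinearMap v

theorem metricTrace_zero {W : Type*} [AddCommGroup W] [Module ℝ W] :
    metricTrace g p (fun _ _ => (0 : W)) = 0 := by
  simp [metricTrace]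

theorem laplacian_const (c : ℝ) : laplacian g (fun _ => c) p = 0 := by
  simp only [laplacian, dirDeriv_const, sub_zero, metricTrace_zero]

theorem grad_const (c : ℝ) : grad g (fun _ => c) p = 0 := by
  rw [← inner_self_eq_zero_iff g, inner_grad, dirDeriv_const]

theorem ricci_eq_sum {ι : Type*} [Fintype ι] {b b' : ι → TangentSpace (𝓡 m) p}
    (hb : IsDualPair g p b b') (v w : TangentSpace (𝓡 m) p) :
    ricci g p v w = ∑ i, g.inner p (curvature g p (b i) v w) (b' i) :=
  metricTrace_eq_sum hb (LinearMap.mk₂ ℝ (fun u u' => g.inner p (curvature g p u v w) u')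
    (fun _ _ _ => by rw [curvature_add_left, map_add, _root_.add_apply])
    (fun _ _ _ => by rw [curvature_smul_left, map_smul, _root_.smul_apply])
    (fun _ _ _ => map_add _ _ _) (fun _ _ _ => map_smul _ _ _))

theorem inner_curvature_self (a b c : TangentSpace (𝓡 m) p) :
    g.inner p (curvature g p a b c) c = 0 := by
  have := inner_curvature_antisymm (h := g) a b c c
  rw [g.symm p c] at this
  linarith

end Functions

/-! ### Umbilical hypersurfaces of Einstein spaces; proof of the equivalence. -/

section Hypersurface

variable {m : ℕ}
  {M : Type*} [TopologicalSpace M] [ChartedSpace (EuclideanSpace ℝ (Fin m)) M]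
  [IsManifold (𝓡 m) ∞ M]
  {N : Type*} [TopologicalSpace N] [ChartedSpace (EuclideanSpace ℝ (Fin (m + 1))) N]
  [IsManifold (𝓡 (m + 1)) ∞ N] {g : Metric m M} {h : Metric (m + 1) N} {φ : M → N} {p : M}
  {lam : ℝ}

/-- The squared norm of the tension field. -/
def tensionSq (g : Metric m M) (h : Metric (m + 1) N) (φ : M → N) (p : M) : ℝ :=
  h.inner (φ p) (tension g h φ p) (tension g h φ p)

theorem contMDiff_tensionSq (hφ : IsIsometricImmersion g h φ) :
    ContMDiff (𝓡 m) 𝓘(ℝ, ℝ) ∞ (tensionSq g h φ) :=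
  fun p => contMDiffAt_inner (smoothAt_tension hφ.1 p) (smoothAt_tension hφ.1 p)

theorem tensionSq_nonneg (p : M) : 0 ≤ tensionSq g h φ p := by
  by_cases h0 : tension g h φ p = 0
  · rw [tensionSq, h0, map_zero]
  · exact (h.pos _ _ h0).le

theorem tension_eq_zero_iff : tension g h φ p = 0 ↔ tensionSq g h φ p = 0 :=
  (inner_self_eq_zero_iff h _).symm

/-- The unit normal vector in the direction of the tension field. -/
def unitTension (g : Metric m M) (h : Metric (m + 1) N) (φ : M → N) (p : M) :
    TangentSpace (𝓡 (m + 1)) (φ p) :=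
  (√(tensionSq g h φ p))⁻¹ • tension g h φ p

theorem inner_unitTension (w : TangentSpace (𝓡 (m + 1)) (φ p)) :
    h.inner (φ p) (unitTension g h φ p) w =
      (√(tensionSq g h φ p))⁻¹ * h.inner (φ p) (tension g h φ p) w := by
  rw [unitTension, map_smul, _root_.smul_apply, smul_eq_mul]

theorem inner_unitTension_tension :
    h.inner (φ p) (unitTension g h φ p) (tension g h φ p) = √(tensionSq g h φ p) := by
  rw [inner_unitTension, ← tensionSq]
  -- At zeros of the tension field both sides are `0`, since `0⁻¹ = 0`; the identity thus holds at
  -- every point.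
  rcases eq_or_ne (√(tensionSq g h φ p)) 0 with h0 | h0
  · rw [h0, inv_zero, zero_mul]
  · nth_rewrite 2 [← Real.mul_self_sqrt (tensionSq_nonneg p)]
    rw [inv_mul_cancel_left₀ h0]

theorem isUnitNormal_unitTension (hφ : IsIsometricImmersion g h φ) (hp : tensionSq g h φ p ≠ 0) :
    IsUnitNormal (m := m) h φ p (unitTension g h φ p) := by
  have h0 : √(tensionSq g h φ p) ≠ 0 :=
    (Real.sqrt_pos.2 (lt_of_le_of_ne (tensionSq_nonneg p) hp.symm)).ne'
  refine ⟨?_, fun v => ?_⟩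
  · rw [inner_unitTension, h.symm, inner_unitTension_tension, inv_mul_cancel₀ h0]
  · rw [h.symm, inner_unitTension, inner_tension_differential hφ, mul_zero]

theorem smoothAt_unitTension (hφ : IsIsometricImmersion g h φ) (hp : tensionSq g h φ p ≠ 0) :
    SmoothAt m φ (unitTension g h φ) p := by
  refine (smoothAt_tension hφ.1 p).smul ?_
  have h0 : √(tensionSq g h φ p) ≠ 0 :=
    (Real.sqrt_pos.2 (lt_of_le_of_ne (tensionSq_nonneg p) hp.symm)).ne'
  have : ContDiffAt ℝ ∞ (fun t : ℝ => (√t)⁻¹) (tensionSq g h φ p) :=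
    (Real.contDiffAt_sqrt hp).inv h0
  exact this.contMDiffAt.comp p (contMDiff_tensionSq hφ p)

/-- The Ricci curvature is a trace over `ν` together with a tangent frame; removing the `ν` term
leaves the trace over the hypersurface. -/
theorem sum_inner_curvature_differential (hφ : IsIsometricImmersion g h φ)
    {ν : TangentSpace (𝓡 (m + 1)) (φ p)} (hν : IsUnitNormal (m := m) h φ p ν)
    (v w : TangentSpace (𝓡 (m + 1)) (φ p)) :
    ∑ i, h.inner (φ p) (curvature h (φ p) (differential φ p (coordBasis p i)) v w)
      (differential φ p (dualBasis g p i)) =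
    ricci h (φ p) v w - h.inner (φ p) (curvature h (φ p) ν v w) ν := by
  rw [ricci_eq_sum (isDualPair_adapted hφ hν.1 fun v => by rw [h.symm, hν.2]),
    Fintype.sum_option]
  simp

/-- In an Einstein space, `∇ν = -k dφ` for a unit normal field `ν` forces `k` to be constant. -/
theorem dirDeriv_eq_zero_of_isEinstein (hm : 2 ≤ m) (hφ : IsIsometricImmersion g h φ)
    (hN : IsEinstein h lam) {V : Π q : M, TangentSpace (𝓡 (m + 1)) (φ q)}
    (hV : ∀ᶠ q in 𝓝 p, SmoothAt m φ V q) (hn : IsUnitNormal (m := m) h φ p (V p)) {k : M → ℝ}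
    (hk : MDifferentiableAt (𝓡 m) 𝓘(ℝ, ℝ) k p)
    (he : ∀ᶠ q in 𝓝 p, ∀ u : TangentSpace (𝓡 m) q,
      covAlong h φ V q u = (-k q) • differential φ q u) (v : TangentSpace (𝓡 m) p) :
    dirDeriv k p v = 0 := by
  have h1 := sum_inner_curvature_differential hφ hn (differential φ p v) (V p)
  rw [inner_curvature_self, hN, hn.2, mul_zero, sub_zero] at h1
  -- The left side becomes `m dk(v) - dk(v)` by Codazzi; the right side is already `0` by the
  -- Einstein condition and antisymmetry of the curvature.
  simp only [curvature_of_covAlong_eq hφ.1 hV hk he, map_sub, map_smul, _root_.sub_apply,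
    _root_.smul_apply, hφ.2, smul_eq_mul, Finset.sum_sub_distrib, ← Finset.mul_sum] at h1
  rw [sum_inner_dualPair (isDualPair_coordBasis g p)] at h1
  have h2 : ∑ i, dirDeriv k p (coordBasis p i) * g.inner p v (dualBasis g p i) =
      dirDeriv k p v := by
    have h3 : (mfderiv (𝓡 m) 𝓘(ℝ, ℝ) k p).toLinearMap
        (∑ i, g.inner p v (dualBasis g p i) • coordBasis p i) =
        ∑ i, g.inner p v (dualBasis g p i) * dirDeriv k p (coordBasis p i) := by
      rw [map_sum]
      exact Finset.sum_congr rfl fun i _ => map_smul _ _ _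
    rw [isDualPair_coordBasis g p v] at h3
    simp only [mul_comm (dirDeriv k p _)]
    exact h3.symm
  rw [h2] at h1
  have hm' : (2 : ℝ) ≤ m := by exact_mod_cast hm
  have h4 : dirDeriv k p v * ((m : ℝ) - 1) = 0 := by linarith
  exact (mul_eq_zero.1 h4).resolve_right (by linarith)

/-- The squared norm is used because it is smooth at zeros of `τ` too, where it has a minimum.
Elsewhere `|τ|² = (m k)²` with `dk = 0`, so no separate study of the zero set is needed. -/
theorem dirDeriv_tensionSq (hm : 2 ≤ m) (hφ : IsIsometricImmersion g h φ)
    (hN : IsEinstein h lam) (hM : IsTotallyUmbilical g h φ) (p : M) (v : TangentSpace (𝓡 m) p) :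
    dirDeriv (tensionSq g h φ) p v = 0 := by
  have hs := contMDiff_tensionSq hφ
  have hd : MDifferentiableAt (𝓡 m) 𝓘(ℝ, ℝ) (tensionSq g h φ) p :=
    (hs p).mdifferentiableAt (by simp)
  by_cases hp : tensionSq g h φ p = 0
  · refine dirDeriv_eq_zero_of_isLocalMin hd (Eventually.of_forall fun q => ?_) v
    rw [hp]
    exact tensionSq_nonneg q
  · have hne : ∀ᶠ q in 𝓝 p, tensionSq g h φ q ≠ 0 := hs.continuous.continuousAt.eventually_ne hp
    have hV : ∀ᶠ q in 𝓝 p, SmoothAt m φ (unitTension g h φ) q :=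
      hne.mono fun q hq => smoothAt_unitTension hφ hq
    set k : M → ℝ := fun q =>
      (1 / (m : ℝ)) * h.inner (φ q) (unitTension g h φ q) (tension g h φ q)
    have hk : MDifferentiableAt (𝓡 m) 𝓘(ℝ, ℝ) k p := by
      have hc : ContMDiffAt (𝓡 m) 𝓘(ℝ, ℝ) ∞ (fun _ : M => 1 / (m : ℝ)) p := contMDiffAt_const
      exact (hc.smul (contMDiffAt_inner (h := h) hV.self_of_nhds
        (smoothAt_tension (g := g) hφ.1 p))).mdifferentiableAt (by simp)
    have hk0 : dirDeriv k p v = 0 := by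
      refine dirDeriv_eq_zero_of_isEinstein hm hφ hN hV (isUnitNormal_unitTension hφ hp) hk ?_ v
      filter_upwards [hne.eventually_nhds] with q hq u
      refine covAlong_normal hφ hM (smoothAt_unitTension hφ hq.self_of_nhds) ?_
        (hq.mono fun r hr w => by rw [h.symm, (isUnitNormal_unitTension hφ hr).2]) u ?_
      · intro h0
        have := (isUnitNormal_unitTension hφ hq.self_of_nhds).1
        rw [h0, map_zero] at this
        exact zero_ne_one this
      · rw [dirDeriv_congr (f' := fun _ => (1 : ℝ))
          (hq.mono fun r hr => (isUnitNormal_unitTension hφ hr).1), dirDeriv_const]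
    have hsk : tensionSq g h φ = fun q => (fun t : ℝ => ((m : ℝ) * t) ^ 2) (k q) := by
      funext q
      have hm0 : (m : ℝ) ≠ 0 := by positivity
      simp only [k, inner_unitTension_tension]
      rw [← mul_assoc, mul_one_div_cancel hm0, one_mul, Real.sq_sqrt (tensionSq_nonneg q)]
    rw [hsk]
    exact dirDeriv_real_comp (F := fun t : ℝ => ((m : ℝ) * t) ^ 2) (by fun_prop) hk hk0

theorem covAlong_tension (hφ : IsIsometricImmersion g h φ) (hM : IsTotallyUmbilical g h φ)
    {s : ℝ} (hs : tensionSq g h φ = fun _ => s) (hs0 : s ≠ 0) (p : M) (u : TangentSpace (𝓡 m) p) :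
    covAlong h φ (tension g h φ) p u = (-(s / m)) • differential φ p u := by
  have hsp : h.inner (φ p) (tension g h φ p) (tension g h φ p) = s := congrFun hs p
  rw [covAlong_normal hφ hM (smoothAt_tension hφ.1 p) ?_
    (Eventually.of_forall fun q w => inner_tension_differential hφ w) u ?_, hsp,
    one_div_mul_eq_div]
  · rintro h0
    rw [h0, map_zero] at hsp
    exact hs0 hsp.symm
  · exact (congrArg (fun f => dirDeriv f p u) hs).trans (dirDeriv_const _ _)

/-- If `∇V = c dφ`, the second covariant derivative of `V` is `c` times the second fundamental form,
whose trace is the tension field. -/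
theorem metricTrace_secondCovDeriv (hφ : IsIsometricImmersion g h φ)
    {V : Π q : M, TangentSpace (𝓡 (m + 1)) (φ q)} {c : ℝ}
    (hV : ∀ (q : M) (u : TangentSpace (𝓡 m) q), covAlong h φ V q u = c • differential φ q u)
    (p : M) : metricTrace g p (secondCovDeriv g h φ V p) = c • tension g h φ p := by
  have h1 : secondCovDeriv g h φ V p = fun u v => c • secondFundamentalForm g h φ p u v := by
    funext u v
    rw [secondCovDeriv, secondFundamentalForm, smul_sub, ← hV p]
    congr 1
    simp only [hV, coordField_eq_fun v]
    exact covAlong_const_smul (smoothAt_pushField hφ.1 (mem_extChartAt_source p) _) c u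
  simp only [h1, tension, metricTrace, Finset.smul_sum, smul_comm c]

/-- Moving the curvature to the other slot costs a sign and leaves a trace over the hypersurface.
The missing normal term has `ν` parallel to `τ`, and `R(ν, τ) = 0`, so the full Ricci curvature
appears. -/
theorem metricTrace_curvature (hφ : IsIsometricImmersion g h φ) (hN : IsEinstein h lam) (p : M) :
    metricTrace g p (fun u v => curvature h (φ p) (differential φ p u) (tension g h φ p)
      (differential φ p v)) = (-lam) • tension g h φ p := by
  have h1 := metricTrace_eq_sum (isDualPair_coordBasis g p) (LinearMap.mk₂ ℝ
    (fun u v => curvature h (φ p) (differential φ p u) (tension g h φ p) (differential φ p v))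
    (fun _ _ _ => by rw [differential_add, curvature_add_left])
    (fun _ _ _ => by rw [differential_smul, curvature_smul_left])
    (fun _ _ _ => by rw [differential_add, curvature_add_right])
    (fun _ _ _ => by rw [differential_smul, curvature_smul_right]))
  simp only [LinearMap.mk₂_apply] at h1
  rw [h1]
  by_cases hp : tensionSq g h φ p = 0
  · rw [tension_eq_zero_iff.2 hp, smul_zero]
    exact Finset.sum_eq_zero fun i _ => curvature_zero_middle _ _
  · refine eq_of_inner_eq (g := h) fun w => ?_
    rw [map_sum, _root_.sum_apply, map_smul, _root_.smul_apply, smul_eq_mul, neg_mul, ← hN]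
    have h2 := sum_inner_curvature_differential hφ (isUnitNormal_unitTension hφ hp)
      (tension g h φ p) w
    have h3 : curvature h (φ p) (unitTension g h φ p) (tension g h φ p) w = 0 := by
      rw [unitTension, curvature_smul_left, curvature_self, smul_zero]
    rw [h3, map_zero, _root_.zero_apply, sub_zero] at h2
    rw [← h2, ← Finset.sum_neg_distrib]
    refine Finset.sum_congr rfl fun i _ => ?_
    rw [inner_curvature_antisymm, h.symm]

theorem bitension_eq (hφ : IsIsometricImmersion g h φ) (hN : IsEinstein h lam) {c : ℝ}
    (hc : ∀ (q : M) (u : TangentSpace (𝓡 m) q),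
      covAlong h φ (tension g h φ) q u = c • differential φ q u) (p : M) :
    bitension g h φ p = (c + lam) • tension g h φ p := by
  rw [bitension, metricTrace_secondCovDeriv hφ hc, metricTrace_curvature hφ hN, ← sub_smul,
    sub_neg_eq_add]

theorem isFBiharmonicSubmanifold_of_isBiharmonic (hφ : IsIsometricImmersion g h φ)
    (hb : IsBiharmonic g h φ) : IsFBiharmonicSubmanifold g h φ := by
  refine ⟨fun _ => 1, contMDiff_const, fun _ => one_pos, fun p => ?_⟩
  rw [fBitension, hb p, laplacian_const, grad_const,
    covAlong_zero_right (smoothAt_tension hφ.1 p)]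
  simp

theorem isBiharmonic_of_isTotallyGeodesic (hφ : IsIsometricImmersion g h φ)
    (hN : IsEinstein h lam) (hg : IsTotallyGeodesic g h φ) : IsBiharmonic g h φ := by
  have h0 : tension g h φ = fun _ => 0 := by
    funext p
    rw [tension_eq_sum hφ.1]
    exact Finset.sum_eq_zero fun i _ => hg _ _ _
  intro p
  rw [bitension_eq (c := 0) hφ hN ?_ p, h0, smul_zero]
  intro q u
  rw [h0, covAlong_zero_left hφ.1, zero_smul]

theorem isTotallyGeodesic_or_of_isFBiharmonicSubmanifold [ConnectedSpace M] (hm : 2 ≤ m)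
    (hφ : IsIsometricImmersion g h φ) (hN : IsEinstein h lam) (hM : IsTotallyUmbilical g h φ)
    (hf : IsFBiharmonicSubmanifold g h φ) :
    IsTotallyGeodesic g h φ ∨
      IsBiharmonic g h φ ∧ 0 ≤ lam ∧ HasConstantMeanCurvature g h φ (√(lam / m)) := by
  obtain ⟨s, hs⟩ := exists_eq_const_of_dirDeriv_eq_zero
    ((contMDiff_tensionSq hφ).mdifferentiable (by simp)) (dirDeriv_tensionSq hm hφ hN hM)
  obtain ⟨p₀⟩ := (inferInstance : Nonempty M)
  have hm0 : (0 : ℝ) < m := by positivity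
  by_cases hs0 : s = 0
  · left
    intro p u v
    rw [secondFundamentalForm_eq_of_umbilical hφ hM, tension_eq_zero_iff.2 (by rw [hs, hs0]),
      smul_zero]
  right
  have hne : ∀ p, tensionSq g h φ p ≠ 0 := fun p => by rwa [hs]
  have hspos : 0 < s := by
    have := tensionSq_nonneg (g := g) (h := h) (φ := φ) p₀
    rw [hs] at this
    exact lt_of_le_of_ne this (Ne.symm hs0)
  have hcov := covAlong_tension hφ hM hs hs0
  have hbi := bitension_eq hφ hN hcov
  obtain ⟨f, hfs, hfpos, hf⟩ := hf
  have hgrad : ∀ p, grad g f p = 0 := by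
    intro p
    -- Pairing with a tangent vector kills the multiples of `τ`; only `-(2s/m) |grad f|²` survives.
    have h1 := congrArg (fun w => h.inner (φ p) w (differential φ p (grad g f p))) (hf p)
    simp only [fBitension, hbi, hcov, map_add, map_smul, _root_.add_apply, _root_.smul_apply,
      inner_tension_differential hφ, hφ.2, smul_eq_mul, mul_zero, zero_add, map_zero,
      _root_.zero_apply] at h1
    have h2 : s / m ≠ 0 := (div_pos hspos hm0).ne'
    rw [← inner_self_eq_zero_iff g p]
    have h3 : (2 * (s / m)) * g.inner p (grad g f p) (grad g f p) = 0 := by linarith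
    exact (mul_eq_zero.1 h3).resolve_left (by positivity)
  obtain ⟨c, rfl⟩ := exists_eq_const_of_dirDeriv_eq_zero (hfs.mdifferentiable (by simp))
    fun p v => by rw [← inner_grad (g := g), hgrad, map_zero, _root_.zero_apply]
  have hlam : lam = s / m := by
    have h1 := hf p₀
    rw [fBitension, hgrad, covAlong_zero_right (smoothAt_tension hφ.1 p₀), laplacian_const,
      hbi, zero_smul, smul_zero, add_zero, add_zero, smul_smul] at h1
    -- With `f` constant the equation reads `f (λ - s/m) τ = 0`, where `f > 0` and `τ ≠ 0`.
    have h2 := (smul_eq_zero.1 h1).resolve_right fun h0 => hne p₀ (tension_eq_zero_iff.1 h0)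
    have h3 := (mul_eq_zero.1 h2).resolve_left (hfpos p₀).ne'
    linarith
  refine ⟨fun p => ?_, ?_, unitTension g h φ, fun p => smoothAt_unitTension hφ (hne p),
    fun p => isUnitNormal_unitTension hφ (hne p), fun p => ?_⟩
  · rw [hbi, hlam, neg_add_cancel, zero_smul]
  · rw [hlam]
    positivity
  · rw [meanCurvature_eq hφ.1, h.symm, inner_unitTension_tension, hs, hlam, div_div, ← sq,
      Real.sqrt_div hspos.le, Real.sqrt_sq hm0.le, one_div_mul_eq_div]

end Hypersurface

end FBiharmonic

end

open FBiharmonic in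
theorem theorem3p6 {m : ℕ} (hm : 2 ≤ m)
    {M : Type*} [TopologicalSpace M] [T2Space M] [SecondCountableTopology M] [ConnectedSpace M]
    [ChartedSpace (EuclideanSpace ℝ (Fin m)) M] [IsManifold (𝓡 m) ∞ M]
    {N : Type*} [TopologicalSpace N] [T2Space N] [SecondCountableTopology N]
    [ChartedSpace (EuclideanSpace ℝ (Fin (m + 1))) N] [IsManifold (𝓡 (m + 1)) ∞ N]
    (g : FBiharmonic.Metric m M) (h : FBiharmonic.Metric (m + 1) N)
    (φ : M → N) (hφ : IsIsometricImmersion g h φ)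
    (lam : ℝ) (hN : IsEinstein h lam) (hM : IsTotallyUmbilical g h φ) :
    IsFBiharmonicSubmanifold g h φ ↔
      IsTotallyGeodesic g h φ ∨
        (IsBiharmonic g h φ ∧ 0 ≤ lam ∧
          (HasConstantMeanCurvature g h φ (√(lam / m)) ∨
            HasConstantMeanCurvature g h φ (-√(lam / m)))) := by
  constructor
  · intro hf
    -- The normal chosen along `τ` always gives the nonnegative root; the opposite normal would give
    -- the other.
    exact (isTotallyGeodesic_or_of_isFBiharmonicSubmanifold hm hφ hN hM hf).imp_right
      fun h' => ⟨h'.1, h'.2.1, Or.inl h'.2.2⟩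
  · rintro (hg | hb)
    · exact isFBiharmonicSubmanifold_of_isBiharmonic hφ
        (isBiharmonic_of_isTotallyGeodesic hφ hN hg)
    · exact isFBiharmonicSubmanifold_of_isBiharmonic hφ hb.1
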